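/- Let $b>3$ and let $g:\mathbb N_0\to[0,\infty)$ be a jump rate function with $g(n)=0$ if and only if $n=0$, whose stationary weights $w(n)=\prod_{k=1}^n \frac1{g(k)}$ satisfy $w(n)\simeq A\,n^{-b}$ as $n\to\infty$ for some constant $A>0$ (the power law case $\lambda=1$); here $a_n\simeq b_n$ means $a_n/b_n\to1$. Let $z(1)=\sum_{n\ge0}w(n)$, let $\nu_1$ be the law under which the occupation numbers $\eta_x$, $x=1,\dots,L$, are i.i.d. with $\nu_1[\eta_x=n]=w(n)/z(1)$, and set $\rho_c=\mathbb E^{\nu_1}[\eta_x]$, $\sigma^2=\mathbb E^{\nu_1}[\eta_x^2]-\rho_c^2$ (both finite) and $A_1=A/z(1)$, so that $\nu_1[\eta_x=n]\simeq A_1n^{-b}$. Let $S_L=\sum_{x=1}^L\eta_x$, $M_L=\max_{1\le x\le L}\eta_x$ and $\mu_{L,N}=\nu_1[\,\cdot\mid S_L=N]$. Let $N=N(L)\in\mathbb N_0$ be a sequence with $N\le\rho_cL$ and define $\omega_L\ge0$ by $$N=\rho_cL-\omega_L\,\sigma^2L^{\frac{b-2}{b-1}} .$$ a) If $\omega_L\to0$,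 then $M_L$ has asymptotically the same distribution under $\mu_{L,N}$ as under $\nu_1$: for all $x>0$, $$\lim_{L\to\infty}\mu_{L,N}\Big[\tfrac{M_L}{L^{1/(b-1)}}\le x\Big]=\lim_{L\to\infty}\nu_1\Big[\tfrac{M_L}{L^{1/(b-1)}}\le x\Big]=\exp\Big\{-\frac{A_1x^{1-b}}{b-1}\Big\}.$$ b) If $\omega_L\to\omega\in(0,\infty)$, then for all $x>0$, $$\lim_{L\to\infty}\mu_{L,N}\Big[\tfrac{M_L}{L^{1/(b-1)}}\le x\Big]=\exp\Big\{-A_1\int_x^\infty e^{-\omega t}\,\frac{dt}{t^b}\Big\}.$$ c) If $\omega_L\to\infty$ and $N/L\to\rho_c$, then there exist real sequences $B_L\to\infty$ and $s_L=\frac{\rho_cL-N}{\sigma^2L}(1+o(1))$ with $B_Ls_L\to\infty$ such that for all $x\in\mathbb R$, $$\lim_{L\to\infty}\mu_{L,N}\Big[\frac{M_L-B_L}{1/s_L}\le x\Big]=\exp\{-e^{-x}\}.$$ -/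

import Mathlib

open MeasureTheory Filter Topology

namespace ZeroRange

/-- The stationary weights `w(n) = ∏_{k=1}^n 1 / g(k)` of the jump rate function `g`. -/
noncomputable def weight (g : ℕ → ℝ) (n : ℕ) : ℝ :=
  ∏ k ∈ Finset.Icc 1 n, 1 / g k

/-- The partition function `z(φ) = ∑_{n ≥ 0} w(n) φ^n`. -/
noncomputable def partitionFunction (g : ℕ → ℝ) (φ : ℝ) : ℝ :=
  ∑' n : ℕ, weight g n * φ ^ n

/-- The one-site marginal of `ν_φ`: the law on `ℕ` which gives mass `w(n) φ^n / z(φ)` to `n`. -/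
noncomputable def marginal (g : ℕ → ℝ) (φ : ℝ) : Measure ℕ :=
  Measure.sum fun n : ℕ =>
    ENNReal.ofReal (weight g n * φ ^ n / partitionFunction g φ) • Measure.dirac n

/-- The homogeneous product measure `ν_φ` on the configurations on `L` sites. -/
noncomputable def grandCanonical (g : ℕ → ℝ) (φ : ℝ) (L : ℕ) : Measure (Fin L → ℕ) :=
  Measure.pi fun _ => marginal g φ

/-- The particle density `R(φ)`, the expectation of an occupation number under `ν_φ`. -/
noncomputable def density (g : ℕ → ℝ) (φ : ℝ) : ℝ :=
  ∫ n : ℕ, (n : ℝ) ∂(marginal g φ)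

/-- The critical density `ρ_c = R(1)`. -/
noncomputable def rhoC (g : ℕ → ℝ) : ℝ := density g 1

/-- The variance `σ²` of an occupation number at the critical fugacity `φ = 1`. -/
noncomputable def sigmaSq (g : ℕ → ℝ) : ℝ :=
  (∫ n : ℕ, (n : ℝ) ^ 2 ∂(marginal g 1)) - rhoC g ^ 2

/-- The number of particles `S_L(η)`. -/
def totalMass {L : ℕ} (η : Fin L → ℕ) : ℕ := ∑ x, η x

/-- The maximal occupation number `M_L(η)`. -/
def maxOcc {L : ℕ} (η : Fin L → ℕ) : ℕ := Finset.univ.sup η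

/-- The canonical measure `μ_{L,N} = ν_1[ · | S_L = N]`. -/
noncomputable def canonical (g : ℕ → ℝ) (L N : ℕ) : Measure (Fin L → ℕ) :=
  ProbabilityTheory.cond (grandCanonical g 1 L) {η | totalMass η = N}

end ZeroRange

/-! Write `p` for the one-site law at fugacity 1. Conditioning on the number of particles is
insensitive to an exponential tilt: replacing p(n) by p(n) e^{-sn} multiplies the weight of every
configuration with N particles by the same factor e^{-sN}. So the tilt s = s_L ≥ 0 may be chosen to
make the mean occupation exactly N/L. Differentiating at s = 0 shows that s is asymptotically the
density deficit divided by σ², that is, s L^{1/(b-1)} ~ ω_L (`exists_tilt`,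
`exists_canonical_tilt`).

The event M_L ≤ K replaces the tilted law by its truncation at K. If Z and W are the masses of the
tilted law and of its truncation, then μ_{L,N}[M_L ≤ K] is (W/Z)^L times a quotient of two
probabilities of the event S_L = N, for i.i.d. occupations under the two normalised laws. A local
limit theorem uniform over dominated arrays (`local_limit`) gives both probabilities the same
Gaussian asymptotics, provided truncation moves the mean by o(L^{-1/2}). The quotient then tends to
1, and if L(Z - W) → τ the probability tends to e^{-τ} (`tendsto_sumWeight_ratio`).

It remains to compute the tails L ∑_{n>K} p(n) e^{-sn}. For bounded ω_L the scale L^{1/(b-1)} turns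
them into A₁ ∫_x^∞ e^{-ωt} t^{-b} dt, and ω = 0 gives the Fréchet law (`tendsto_tail_of_scale`). For
ω_L → ∞ the exponential dominates: with B solving s B^b e^{sB} = A₁ L, the cut-off B + x/s gives
e^{-x} (`tendsto_tail_of_damped`). The assumption b > 3 provides the finite variance and makes the
maximum o(√L), which controls the shift of the mean. -/

namespace ZeroRange

/-! ### Atomic measures on ℕ and total weights at a fixed particle number -/

/-- The measure on `ℕ` with mass `f n` at `n`. -/
noncomputable def atomMeasure (f : ℕ → ℝ) : Measure ℕ :=
  Measure.sum fun n : ℕ => ENNReal.ofReal (f n) • Measure.dirac n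

lemma atomMeasure_singleton (f : ℕ → ℝ) (n : ℕ) :
    atomMeasure f {n} = ENNReal.ofReal (f n) := by
  rw [atomMeasure, Measure.sum_apply _ (measurableSet_singleton n), tsum_eq_single n]
  · simp
  · intro m hm
    simp [hm]

lemma atomMeasure_real_singleton {f : ℕ → ℝ} (hf : ∀ n, 0 ≤ f n) (n : ℕ) :
    (atomMeasure f).real {n} = f n := by
  rw [Measure.real, atomMeasure_singleton, ENNReal.toReal_ofReal (hf n)]

lemma isFiniteMeasure_atomMeasure {f : ℕ → ℝ} (hf : ∀ n, 0 ≤ f n) (hs : Summable f) :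
    IsFiniteMeasure (atomMeasure f) := by
  constructor
  rw [atomMeasure, Measure.sum_apply _ MeasurableSet.univ]
  simp only [Measure.smul_apply, measure_univ, smul_eq_mul, mul_one]
  rw [← ENNReal.ofReal_tsum_of_nonneg hf hs]
  exact ENNReal.ofReal_lt_top

lemma integrable_atomMeasure {E : Type*} [NormedAddCommGroup E] {f : ℕ → ℝ}
    (hf : ∀ n, 0 ≤ f n) {F : ℕ → E} (hs : Summable fun n => f n * ‖F n‖) :
    Integrable F (atomMeasure f) := by
  refine ⟨StronglyMeasurable.of_discrete.aestronglyMeasurable, ?_⟩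
  rw [HasFiniteIntegral, lintegral_countable']
  have : ∀ n, ‖F n‖ₑ * atomMeasure f {n} = ENNReal.ofReal (f n * ‖F n‖) := by
    intro n
    rw [atomMeasure_singleton, ENNReal.ofReal_mul (hf n), ofReal_norm, mul_comm]
  simp_rw [this]
  rw [← ENNReal.ofReal_tsum_of_nonneg (fun n => mul_nonneg (hf n) (norm_nonneg _)) hs]
  exact ENNReal.ofReal_lt_top

lemma integral_atomMeasure {E : Type*} [NormedAddCommGroup E] [NormedSpace ℝ E] [CompleteSpace E]
    {f : ℕ → ℝ} (hf : ∀ n, 0 ≤ f n) {F : ℕ → E} (hs : Summable fun n => f n * ‖F n‖) :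
    ∫ n, F n ∂(atomMeasure f) = ∑' n, f n • F n := by
  rw [integral_countable (integrable_atomMeasure hf hs)]
  simp_rw [atomMeasure_real_singleton hf]

/-- The total weight `∑ ∏ f(η_x)` of the configurations on `L` sites with `N` particles. -/
noncomputable def sumWeight (f : ℕ → ℝ) (L N : ℕ) : ℝ :=
  ∑ η ∈ Finset.piAntidiag (Finset.univ : Finset (Fin L)) N, ∏ x, f (η x)

lemma mem_piAntidiag_univ {L N : ℕ} {η : Fin L → ℕ} :
    η ∈ Finset.piAntidiag (Finset.univ : Finset (Fin L)) N ↔ totalMass η = N := by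
  simp [Finset.mem_piAntidiag, totalMass]

lemma sumWeight_congr {f₁ f₂ : ℕ → ℝ} {L N : ℕ} (h : ∀ n, f₁ n = f₂ n) :
    sumWeight f₁ L N = sumWeight f₂ L N := by
  rw [funext h]

lemma sumWeight_const_mul (c : ℝ) (f : ℕ → ℝ) (L N : ℕ) :
    sumWeight (fun n => c * f n) L N = c ^ L * sumWeight f L N := by
  simp [sumWeight, Finset.prod_mul_distrib, Finset.mul_sum]

/-- The tilt factors multiply to e^{-sN}, which depends on the configuration only through its
particle number. This is why the canonical measure does not see the tilt. -/
lemma sumWeight_mul_exp (f : ℕ → ℝ) (s : ℝ) (L N : ℕ) :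
    sumWeight (fun n => f n * Real.exp (-(s * n))) L N
      = Real.exp (-(s * N)) * sumWeight f L N := by
  rw [sumWeight, sumWeight, Finset.mul_sum]
  refine Finset.sum_congr rfl fun η hη => ?_
  rw [Finset.prod_mul_distrib, ← Real.exp_sum, mul_comm]
  rw [mem_piAntidiag_univ, totalMass] at hη
  rw [← hη, Nat.cast_sum, Finset.mul_sum, Finset.sum_neg_distrib]

lemma pi_atomMeasure_real_totalMass {f : ℕ → ℝ} (hf : ∀ n, 0 ≤ f n) (hs : Summable f)
    (L N : ℕ) (P : ℕ → Prop) [DecidablePred P] :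
    (Measure.pi fun _ : Fin L => atomMeasure f).real {η | totalMass η = N ∧ ∀ x, P (η x)}
      = sumWeight (fun n => if P n then f n else 0) L N := by
  have := isFiniteMeasure_atomMeasure hf hs
  have hset : {η : Fin L → ℕ | totalMass η = N ∧ ∀ x, P (η x)}
      = ↑((Finset.piAntidiag (Finset.univ : Finset (Fin L)) N).filter fun η => ∀ x, P (η x)) := by
    ext η
    simp only [Set.mem_ofPred_eq, Finset.coe_filter, mem_piAntidiag_univ]
  rw [hset, ← sum_measureReal_singleton, sumWeight, Finset.sum_filter]
  refine Finset.sum_congr rfl fun η _ => ?_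
  split_ifs with h
  · rw [Measure.real, Measure.pi_singleton, ENNReal.toReal_prod]
    refine Finset.prod_congr rfl fun x _ => ?_
    rw [if_pos (h x)]
    exact atomMeasure_real_singleton hf _
  · push Not at h
    obtain ⟨x, hx⟩ := h
    exact (Finset.prod_eq_zero (Finset.mem_univ x) (if_neg hx)).symm

lemma pi_atomMeasure_real_totalMass_eq {f : ℕ → ℝ} (hf : ∀ n, 0 ≤ f n) (hs : Summable f)
    (L N : ℕ) :
    (Measure.pi fun _ : Fin L => atomMeasure f).real {η | totalMass η = N} = sumWeight f L N := by
  simpa using pi_atomMeasure_real_totalMass hf hs L N (fun _ => True)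

/-! ### Characteristic functions and Fourier inversion -/

/-- The characteristic function `t ↦ ∑ f(n) e^{itn}`. -/
noncomputable def charSum (f : ℕ → ℝ) (t : ℝ) : ℂ :=
  ∑' n : ℕ, (f n : ℂ) * Complex.exp (t * n * Complex.I)

lemma integral_exp_int_mul_I (k : ℤ) :
    ∫ t in (-Real.pi)..Real.pi, Complex.exp (t * k * Complex.I)
      = if k = 0 then (2 * Real.pi : ℂ) else 0 := by
  split_ifs with hk
  · subst hk
    simp
    ring
  · have hc : (k : ℂ) * Complex.I ≠ 0 :=
      mul_ne_zero (by exact_mod_cast hk) Complex.I_ne_zero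
    have : ∀ t : ℝ, Complex.exp (t * k * Complex.I) = Complex.exp ((k * Complex.I) * t) := by
      intro t
      congr 1
      ring
    simp_rw [this]
    rw [integral_exp_mul_complex hc]
    have h2 : Complex.exp (k * Complex.I * (Real.pi : ℝ))
        = Complex.exp (k * Complex.I * ((-Real.pi : ℝ) : ℂ)) := by
      rw [Complex.exp_eq_exp_iff_exists_int]
      refine ⟨k, ?_⟩
      push_cast
      ring
    rw [h2, sub_self, zero_div]

/-- Fourier inversion for the total weight of the configurations with `N` particles. -/
lemma sumWeight_eq_integral {f : ℕ → ℝ} (hf : ∀ n, 0 ≤ f n) (hs : Summable f) (L N : ℕ) :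
    ((2 * Real.pi * sumWeight f L N : ℝ) : ℂ)
      = ∫ t in (-Real.pi)..Real.pi,
          charSum f t ^ L * Complex.exp (-(t * N * Complex.I)) := by
  have := isFiniteMeasure_atomMeasure hf hs
  set μ := Measure.pi fun _ : Fin L => atomMeasure f with hμ
  have hchar : ∀ t : ℝ, charSum f t = ∫ n : ℕ, Complex.exp (t * n * Complex.I) ∂(atomMeasure f) := by
    intro t
    rw [integral_atomMeasure hf]
    · simp [charSum]
    · refine hs.congr fun n => ?_
      rw [show (t : ℂ) * n * Complex.I = ((t * n : ℝ) : ℂ) * Complex.I by push_cast; ring,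
        Complex.norm_exp_ofReal_mul_I, mul_one]
  have hprod : ∀ t : ℝ, charSum f t ^ L * Complex.exp (-(t * N * Complex.I))
      = ∫ η, Complex.exp (t * (((totalMass η : ℤ) - (N : ℤ) : ℤ)) * Complex.I) ∂μ := by
    intro t
    have h1 := integral_fintype_prod_eq_pow (𝕜 := ℂ) (ι := Fin L) (μ := atomMeasure f)
      (fun n : ℕ => Complex.exp (t * n * Complex.I))
    rw [Fintype.card_fin] at h1
    rw [hchar, ← h1, ← integral_mul_const]
    refine integral_congr_ae (Eventually.of_forall fun η => ?_)
    simp only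
    rw [← Complex.exp_sum, ← Complex.exp_add]
    congr 1
    rw [← Finset.sum_mul, ← Finset.mul_sum, totalMass]
    push_cast
    ring
  simp_rw [hprod]
  -- After Fubini, orthogonality of the exponentials leaves 2π times the indicator of the event that
  -- the total is N.
  rw [intervalIntegral.integral_of_le (by linarith [Real.pi_pos]), integral_integral_swap]
  · simp_rw [← intervalIntegral.integral_of_le (show -Real.pi ≤ Real.pi by linarith [Real.pi_pos]),
      integral_exp_int_mul_I]
    have : ∀ η : Fin L → ℕ, (if (totalMass η : ℤ) - (N : ℤ) = 0 then (2 * Real.pi : ℂ) else 0)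
        = (((2 * Real.pi) * Set.indicator {η : Fin L → ℕ | totalMass η = N} 1 η : ℝ) : ℂ) := by
      intro η
      by_cases h : totalMass η = N
      · simp [h]
      · have h' : ¬ ((totalMass η : ℤ) - (N : ℤ) = 0) := by omega
        simp [h, h']
    simp_rw [this]
    rw [integral_complex_ofReal, integral_const_mul, integral_indicator_one
      (Set.to_countable _).measurableSet, hμ, pi_atomMeasure_real_totalMass_eq hf hs]
  · refine Integrable.of_bound ?_ 1 (Eventually.of_forall ?_)
    · refine Measurable.aestronglyMeasurable ?_
      simp only [Function.uncurry_def]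
      have h1 : Measurable fun q : ℝ × (Fin L → ℕ) => (((totalMass q.2 : ℤ) - (N : ℤ) : ℤ) : ℂ) :=
        (measurable_of_countable fun η : Fin L → ℕ =>
          (((totalMass η : ℤ) - (N : ℤ) : ℤ) : ℂ)).comp measurable_snd
      fun_prop
    · rintro ⟨t, η⟩
      simp only [Function.uncurry]
      rw [← Complex.ofReal_intCast, ← Complex.ofReal_mul, Complex.norm_exp_ofReal_mul_I]

/-- No smallness of v is assumed, so this bound can dominate a sum over all n. For |v| ≥ 1 it comes
from |e^{iv} - 1| ≤ |v| and 2|v| ≤ 2v². -/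
lemma norm_exp_ofReal_mul_I_sub_le (v : ℝ) :
    ‖Complex.exp (v * Complex.I) - 1 - v * Complex.I‖ ≤ 2 * v ^ 2 := by
  have hn : ‖(v : ℂ) * Complex.I‖ = |v| := by simp
  rcases le_total |v| 1 with h | h
  · have := Complex.norm_exp_sub_one_sub_id_le (x := v * Complex.I) (by rwa [hn])
    rw [hn, sq_abs] at this
    nlinarith [sq_nonneg v]
  · have h1 : ‖Complex.exp (v * Complex.I) - 1‖ ≤ |v| := by
      have := Real.norm_exp_I_mul_ofReal_sub_one_le (x := v)
      rwa [mul_comm, Real.norm_eq_abs] at this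
    have h2 := norm_sub_le (Complex.exp (v * Complex.I) - 1) (v * Complex.I)
    rw [hn] at h2
    nlinarith [sq_abs v]

lemma norm_exp_ofReal_mul_I_sub_sub_le {v : ℝ} (hv : |v| ≤ 1) :
    ‖Complex.exp (v * Complex.I) - 1 - v * Complex.I + v ^ 2 / 2‖ ≤ |v| ^ 3 := by
  have hn : ‖(v : ℂ) * Complex.I‖ = |v| := by simp
  have := Complex.exp_bound (x := v * Complex.I) (by rwa [hn]) (n := 3) (by norm_num)
  rw [hn] at this
  have h2 : Complex.exp (v * Complex.I) - 1 - v * Complex.I + v ^ 2 / 2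
      = Complex.exp (v * Complex.I)
        - ∑ m ∈ Finset.range 3, (v * Complex.I) ^ m / (m.factorial : ℂ) := by
    simp [Finset.sum_range_succ, mul_pow, Nat.factorial]
    ring
  rw [h2]
  refine this.trans ?_
  norm_num [Nat.factorial]
  nlinarith [pow_nonneg (abs_nonneg v) 3]

/-- The sum is 2 cos(t/2) e^{it/2}, and cos y ≤ 1 - 2y²/π² for |y| ≤ π. -/
lemma norm_one_add_exp_le {t : ℝ} (ht : |t| ≤ Real.pi) :
    ‖1 + Complex.exp (t * Complex.I)‖ ≤ 2 - t ^ 2 / Real.pi ^ 2 := by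
  have hπ := Real.pi_pos
  have hE : 1 + Complex.exp (t * Complex.I)
      = ((2 * Real.cos (t / 2) : ℝ) : ℂ) * Complex.exp ((t / 2 : ℝ) * Complex.I) := by
    push_cast
    rw [Complex.two_cos, add_mul, ← Complex.exp_add, ← Complex.exp_add]
    rw [add_comm]
    congr 1
    · congr 1
      ring
    · rw [← Complex.exp_zero]
      congr 1
      ring
  rw [hE, norm_mul, Complex.norm_exp_ofReal_mul_I, mul_one, Complex.norm_real, Real.norm_eq_abs,
    abs_of_nonneg]
  · have := Real.cos_le_one_sub_mul_cos_sq (x := t / 2)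
      (by rw [abs_div, abs_of_pos (zero_lt_two (α := ℝ))]; linarith)
    have h2 : 2 / Real.pi ^ 2 * (t / 2) ^ 2 = t ^ 2 / Real.pi ^ 2 / 2 := by ring
    linarith
  · have := abs_le.mp ht
    have := Real.cos_nonneg_of_mem_Icc (x := t / 2) ⟨by linarith, by linarith⟩
    linarith

lemma norm_mul_exp_nat (a t : ℝ) (ha : 0 ≤ a) (n : ℕ) :
    ‖(a : ℂ) * Complex.exp (t * n * Complex.I)‖ = a := by
  rw [show (t : ℂ) * n * Complex.I = ((t * n : ℝ) : ℂ) * Complex.I by push_cast; ring, norm_mul,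
    Complex.norm_exp_ofReal_mul_I, mul_one, Complex.norm_real, Real.norm_of_nonneg ha]

lemma summable_charSum {q : ℕ → ℝ} (hq : ∀ n, 0 ≤ q n) (hs : Summable q) (t : ℝ) :
    Summable fun n : ℕ => (q n : ℂ) * Complex.exp (t * n * Complex.I) :=
  Summable.of_norm (hs.congr fun n => (norm_mul_exp_nat (q n) t (hq n) n).symm)

/-- Two adjacent atoms of mass at least δ contribute δ(1 + e^{it}), whose modulus falls short of 2δ
by a multiple of t²; the rest of the mass is bounded trivially. The bound holds on all of [-π, π]
and depends on the law only through δ, so it is uniform along an array. -/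
lemma norm_charSum_le {q : ℕ → ℝ} (hq : ∀ n, 0 ≤ q n) (hs : HasSum q 1) {δ : ℝ} (hδ : 0 ≤ δ)
    (h0 : δ ≤ q 0) (h1 : δ ≤ q 1) {t : ℝ} (ht : |t| ≤ Real.pi) :
    ‖charSum q t‖ ≤ Real.exp (-(δ / Real.pi ^ 2 * t ^ 2)) := by
  have hsum := summable_charSum hq hs.summable t
  have hsplit := hsum.sum_add_tsum_nat_add 2
  have hq2 := hs.summable.sum_add_tsum_nat_add 2
  rw [hs.tsum_eq] at hq2
  simp only [Finset.sum_range_succ, Finset.sum_range_zero, zero_add] at hsplit hq2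
  have htail : ‖∑' n : ℕ, (q (n + 2) : ℂ) * Complex.exp (t * (n + 2 : ℕ) * Complex.I)‖
      ≤ ∑' n : ℕ, q (n + 2) := by
    refine tsum_of_norm_bounded ((summable_nat_add_iff 2).mpr hs.summable).hasSum fun n => ?_
    rw [norm_mul_exp_nat _ _ (hq _)]
  have hhead : ‖(q 0 : ℂ) * Complex.exp (t * (0 : ℕ) * Complex.I)
      + (q 1 : ℂ) * Complex.exp (t * (1 : ℕ) * Complex.I)‖
      ≤ δ * (2 - t ^ 2 / Real.pi ^ 2) + (q 0 - δ) + (q 1 - δ) := by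
    have : (q 0 : ℂ) * Complex.exp (t * (0 : ℕ) * Complex.I)
        + (q 1 : ℂ) * Complex.exp (t * (1 : ℕ) * Complex.I)
        = (δ : ℂ) * (1 + Complex.exp (t * Complex.I)) + ((q 0 - δ : ℝ) : ℂ)
          + ((q 1 - δ : ℝ) : ℂ) * Complex.exp (t * (1 : ℕ) * Complex.I) := by
      push_cast
      simp
      ring
    rw [this]
    refine (norm_add₃_le).trans ?_
    rw [norm_mul_exp_nat _ _ (by linarith), norm_mul, Complex.norm_real, Complex.norm_real,
      Real.norm_of_nonneg hδ, Real.norm_of_nonneg (show 0 ≤ q 0 - δ by linarith)]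
    have := mul_le_mul_of_nonneg_left (norm_one_add_exp_le ht) hδ
    linarith
  have hle : ‖charSum q t‖ ≤ 1 - δ / Real.pi ^ 2 * t ^ 2 := by
    rw [charSum, ← hsplit]
    refine (norm_add_le _ _).trans ((add_le_add hhead htail).trans (le_of_eq ?_))
    have : δ * (2 - t ^ 2 / Real.pi ^ 2) = 2 * δ - δ / Real.pi ^ 2 * t ^ 2 := by ring
    linarith
  refine hle.trans ?_
  have := Real.add_one_le_exp (-(δ / Real.pi ^ 2 * t ^ 2))
  linarith

/-! ### Dominated arrays and the local limit theorem -/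

/-- A probability law on `ℕ` with finite second moment which charges `0` and `1`. -/
structure FiniteVarianceLaw (p : ℕ → ℝ) : Prop where
  nonneg : ∀ n, 0 ≤ p n
  hasSum : HasSum p 1
  pos_zero : 0 < p 0
  pos_one : 0 < p 1
  summable_sq : Summable fun n : ℕ => (n : ℝ) ^ 2 * p n

/-- A sequence of probability laws `q L` on `ℕ`, dominated by a multiple of a law `p` with finite
second moment and converging to it pointwise. -/
structure DominatedArray (p : ℕ → ℝ) (q : ℕ → ℕ → ℝ) : Prop where
  nonneg : ∀ L n, 0 ≤ q L n
  hasSum : ∀ᶠ L in atTop, HasSum (q L) 1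
  dom : ∃ C, 0 ≤ C ∧ ∀ᶠ L in atTop, ∀ n, q L n ≤ C * p n
  lim : ∀ n, Tendsto (fun L => q L n) atTop (𝓝 (p n))
  limit : FiniteVarianceLaw p

namespace FiniteVarianceLaw

variable {p : ℕ → ℝ}

lemma summable_mean (h : FiniteVarianceLaw p) : Summable fun n : ℕ => (n : ℝ) * p n := by
  refine Summable.of_nonneg_of_le (fun n => mul_nonneg n.cast_nonneg (h.nonneg n)) (fun n => ?_)
    h.summable_sq
  refine mul_le_mul_of_nonneg_right ?_ (h.nonneg n)
  rw [sq]
  rcases Nat.eq_zero_or_pos n with rfl | hn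
  · simp
  · have : (1 : ℝ) ≤ n := by exact_mod_cast hn
    nlinarith

lemma summable_sq_sub (h : FiniteVarianceLaw p) (M : ℝ) :
    Summable fun n : ℕ => ((n : ℝ) - M) ^ 2 * p n := by
  have h1 := h.summable_mean
  refine ((h.summable_sq.sub (h1.mul_left (2 * M))).add (h.hasSum.summable.mul_left (M ^ 2))).congr
    fun n => ?_
  ring

/-- Charging 1 makes the mean positive, and charging 0 then makes the term n = 0 positive. -/
lemma variance_pos (h : FiniteVarianceLaw p) :
    0 < ∑' n : ℕ, ((n : ℝ) - ∑' k : ℕ, (k : ℝ) * p k) ^ 2 * p n := by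
  have hmean := h.summable_mean
  have hρ : 0 < ∑' k : ℕ, (k : ℝ) * p k := by
    refine hmean.tsum_pos (fun n => mul_nonneg n.cast_nonneg (h.nonneg n)) 1 ?_
    simpa using h.pos_one
  refine (h.summable_sq_sub _).tsum_pos
    (fun n => mul_nonneg (sq_nonneg _) (h.nonneg n)) 0 ?_
  refine mul_pos ?_ h.pos_zero
  simp only [Nat.cast_zero, zero_sub, neg_sq]
  exact pow_pos hρ 2

end FiniteVarianceLaw

namespace DominatedArray

variable {p : ℕ → ℝ} {q : ℕ → ℕ → ℝ}

lemma summable_mul (h : DominatedArray p q) {L : ℕ} {C : ℝ} (hC : ∀ n, q L n ≤ C * p n)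
    {F : ℕ → ℝ} (hF : ∀ n, 0 ≤ F n) (hs : Summable fun n => F n * p n) :
    Summable fun n => F n * q L n := by
  refine Summable.of_nonneg_of_le (fun n => mul_nonneg (hF n) (h.nonneg L n)) (fun n => ?_)
    (hs.mul_left C)
  calc F n * q L n ≤ F n * (C * p n) := mul_le_mul_of_nonneg_left (hC n) (hF n)
    _ = C * (F n * p n) := by ring

lemma tendsto_mean (h : DominatedArray p q) :
    Tendsto (fun L => ∑' n : ℕ, (n : ℝ) * q L n) atTop (𝓝 (∑' n : ℕ, (n : ℝ) * p n)) := by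
  obtain ⟨C, hC0, hC⟩ := h.dom
  refine tendsto_tsum_of_dominated_convergence
    ((h.limit.summable_mean).mul_left C) (fun n => (h.lim n).const_mul _) ?_
  filter_upwards [hC] with L hL n
  rw [Real.norm_of_nonneg (mul_nonneg n.cast_nonneg (h.nonneg L n))]
  calc (n : ℝ) * q L n ≤ n * (C * p n) := mul_le_mul_of_nonneg_left (hL n) n.cast_nonneg
    _ = C * (n * p n) := by ring

lemma tendsto_mul_exp_sub (y : ℕ → ℝ) (u y₀ : ℝ) (hy : Tendsto y atTop (𝓝 y₀)) :
    Tendsto (fun L : ℕ => (L : ℂ) * (Complex.exp ((u / √L * y L : ℝ) * Complex.I) - 1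
      - (u / √L * y L : ℝ) * Complex.I)) atTop (𝓝 ((-(u ^ 2 * y₀ ^ 2) / 2 : ℝ) : ℂ)) := by
  set v : ℕ → ℝ := fun L => u / √L * y L with hv
  have hsq : Tendsto (fun L : ℕ => √(L : ℝ)) atTop atTop :=
    Real.tendsto_sqrt_atTop.comp tendsto_natCast_atTop_atTop
  have hv0 : Tendsto v atTop (𝓝 0) := by
    have := (hsq.const_div_atTop u).mul hy
    simpa using this
  have hLv : Tendsto (fun L : ℕ => (L : ℝ) * v L ^ 2) atTop (𝓝 (u ^ 2 * y₀ ^ 2)) := by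
    refine ((hy.pow 2).const_mul (u ^ 2)).congr' ?_
    filter_upwards [eventually_gt_atTop 0] with L hL
    have hL' : (0 : ℝ) < L := by exact_mod_cast hL
    simp only [hv]
    rw [mul_pow, div_pow, Real.sq_sqrt hL'.le]
    field_simp
  have hmain : Tendsto (fun L : ℕ => (L : ℂ) * (Complex.exp ((v L : ℝ) * Complex.I) - 1
      - (v L : ℝ) * Complex.I + (v L : ℂ) ^ 2 / 2)) atTop (𝓝 0) := by
    have hb : Tendsto (fun L : ℕ => ((L : ℝ) * v L ^ 2) * |v L|) atTop (𝓝 0) := by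
      simpa using hLv.mul hv0.abs
    refine squeeze_zero_norm' ?_ hb
    have : ∀ᶠ L in atTop, |v L| ≤ 1 := by
      have := hv0.abs
      rw [abs_zero] at this
      exact this.eventually_le_const zero_lt_one
    filter_upwards [this] with L hL
    rw [norm_mul, Complex.norm_natCast]
    calc (L : ℝ) * _ ≤ L * |v L| ^ 3 :=
          mul_le_mul_of_nonneg_left (norm_exp_ofReal_mul_I_sub_sub_le hL) L.cast_nonneg
      _ = L * v L ^ 2 * |v L| := by rw [← sq_abs (v L)]; ring
  have h2 : Tendsto (fun L : ℕ => (((L : ℝ) * v L ^ 2 / 2 : ℝ) : ℂ)) atTop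
      (𝓝 ((u ^ 2 * y₀ ^ 2 / 2 : ℝ) : ℂ)) :=
    (Complex.continuous_ofReal.tendsto _).comp (hLv.div_const 2)
  have h3 := hmain.sub h2
  rw [zero_sub, ← Complex.ofReal_neg, ← neg_div] at h3
  refine h3.congr fun L => ?_
  change _ = (L : ℂ) * (Complex.exp ((v L : ℝ) * Complex.I) - 1 - (v L : ℝ) * Complex.I)
  push_cast
  ring

/-- Centring at the mean of `q L` removes the linear term, so the expression is L ∑ q(n) (e^{iv} - 1
- iv) with v = (u/√L)(n - m). Each summand tends to its quadratic term, and all are dominated by a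
multiple of (n² + M²) p(n), where M bounds the means. -/
lemma tendsto_centered (h : DominatedArray p q) (u : ℝ) :
    Tendsto (fun L : ℕ => (L : ℂ) * (Complex.exp (-((u / √L : ℝ) *
        (∑' n : ℕ, (n : ℝ) * q L n : ℝ) * Complex.I)) * charSum (q L) (u / √L) - 1)) atTop
      (𝓝 ((-(u ^ 2 * ∑' n : ℕ, ((n : ℝ) - ∑' k : ℕ, (k : ℝ) * p k) ^ 2 * p n) / 2 : ℝ) : ℂ)) := by
  obtain ⟨C, hC0, hC⟩ := h.dom
  set m : ℕ → ℝ := fun L => ∑' n : ℕ, (n : ℝ) * q L n with hm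
  set ρ : ℝ := ∑' k : ℕ, (k : ℝ) * p k with hρ
  have hmρ : Tendsto m atTop (𝓝 ρ) := h.tendsto_mean
  obtain ⟨M, hM0, hM⟩ : ∃ M : ℝ, 0 ≤ M ∧ ∀ᶠ L in atTop, |m L| ≤ M := by
    refine ⟨|ρ| + 1, by positivity, ?_⟩
    exact hmρ.abs.eventually_le_const (by linarith)
  have hlim : Tendsto (fun L : ℕ => ∑' n : ℕ, (L : ℂ) * ((q L n : ℂ) *
      (Complex.exp ((u / √L * ((n : ℝ) - m L) : ℝ) * Complex.I) - 1
        - (u / √L * ((n : ℝ) - m L) : ℝ) * Complex.I))) atTop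
      (𝓝 (∑' n : ℕ, (p n : ℂ) * ((-(u ^ 2 * ((n : ℝ) - ρ) ^ 2) / 2 : ℝ) : ℂ))) := by
    refine tendsto_tsum_of_dominated_convergence
      (bound := fun n : ℕ => 4 * u ^ 2 * C * ((n : ℝ) ^ 2 * p n) + 4 * u ^ 2 * C * M ^ 2 * p n)
      ((h.limit.summable_sq.mul_left _).add (h.limit.hasSum.summable.mul_left _)) (fun n => ?_) ?_
    · have := ((Complex.continuous_ofReal.tendsto _).comp (h.lim n)).mul
        (tendsto_mul_exp_sub (fun L => (n : ℝ) - m L) u ((n : ℝ) - ρ) (hmρ.const_sub _))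
      refine this.congr fun L => ?_
      simp only [Function.comp]
      ring
    · filter_upwards [hC, hM, eventually_gt_atTop 0] with L hCL hML hL n
      have hL' : (0 : ℝ) < L := by exact_mod_cast hL
      rw [norm_mul, norm_mul, Complex.norm_natCast, Complex.norm_real,
        Real.norm_of_nonneg (h.nonneg L n)]
      have h1 := norm_exp_ofReal_mul_I_sub_le (u / √L * ((n : ℝ) - m L))
      have h2 : (u / √L * ((n : ℝ) - m L)) ^ 2 = u ^ 2 * ((n : ℝ) - m L) ^ 2 / L := by
        rw [mul_pow, div_pow, Real.sq_sqrt hL'.le]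
        ring
      have h3 : ((n : ℝ) - m L) ^ 2 ≤ 2 * (n : ℝ) ^ 2 + 2 * M ^ 2 := by
        have := sq_le_sq' (by linarith [neg_abs_le (m L)]) ((le_abs_self (m L)).trans hML)
        nlinarith [sq_nonneg ((n : ℝ) + m L)]
      have hp := h.limit.nonneg n
      calc (L : ℝ) * (q L n * _)
          ≤ L * ((C * p n) * (2 * (u ^ 2 * ((n : ℝ) - m L) ^ 2 / L))) := by
            rw [← h2]
            gcongr
            exact hCL n
        _ = 2 * u ^ 2 * (C * p n) * ((n : ℝ) - m L) ^ 2 := by field_simp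
        _ ≤ 2 * u ^ 2 * (C * p n) * (2 * (n : ℝ) ^ 2 + 2 * M ^ 2) := by gcongr
        _ = _ := by ring
  have hval : ∑' n : ℕ, (p n : ℂ) * ((-(u ^ 2 * ((n : ℝ) - ρ) ^ 2) / 2 : ℝ) : ℂ)
      = ((-(u ^ 2 * ∑' n : ℕ, ((n : ℝ) - ρ) ^ 2 * p n) / 2 : ℝ) : ℂ) := by
    rw [show (-(u ^ 2 * ∑' n : ℕ, ((n : ℝ) - ρ) ^ 2 * p n) / 2 : ℝ)
      = (-u ^ 2 / 2) * ∑' n : ℕ, ((n : ℝ) - ρ) ^ 2 * p n by ring, ← tsum_mul_left,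
      Complex.ofReal_tsum]
    refine tsum_congr fun n => ?_
    push_cast
    ring
  rw [← hval]
  refine hlim.congr' ?_
  filter_upwards [h.hasSum, hC] with L hsL hCL
  have hmean : Summable fun n : ℕ => (n : ℝ) * q L n :=
    h.summable_mul hCL (fun n => n.cast_nonneg) (h.limit.summable_mean)
  set t : ℝ := u / √L with ht
  have hA := (summable_charSum (h.nonneg L) hsL.summable t).hasSum.mul_left
    (Complex.exp (-((t : ℂ) * (m L : ℂ) * Complex.I)))
  have hB := Complex.hasSum_ofReal.mpr hsL
  have hD : HasSum (fun n : ℕ => (((n : ℝ) - m L) * q L n : ℝ)) 0 := by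
    have := hmean.hasSum.sub (hsL.mul_left (m L))
    rw [mul_one, sub_self] at this
    refine this.congr_fun fun n => ?_
    ring
  have hD' := (Complex.hasSum_ofReal.mpr hD).mul_left ((t : ℂ) * Complex.I)
  have hT := ((hA.sub hB).sub hD').mul_left (L : ℂ)
  rw [Complex.ofReal_zero, mul_zero, sub_zero, Complex.ofReal_one] at hT
  rw [show charSum (q L) t = ∑' n : ℕ, (q L n : ℂ) * Complex.exp (t * n * Complex.I) from rfl,
    ← hT.tsum_eq]
  refine tsum_congr fun n => ?_
  have hexp : Complex.exp (((t * ((n : ℝ) - m L) : ℝ) : ℂ) * Complex.I)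
      = Complex.exp (-((t : ℂ) * (m L : ℂ) * Complex.I)) * Complex.exp (t * n * Complex.I) := by
    rw [← Complex.exp_add]
    congr 1
    push_cast
    ring
  rw [hexp]
  push_cast
  ring

/-- Local limit theorem for dominated arrays of laws on `ℕ`. -/
theorem local_limit (h : DominatedArray p q) {N : ℕ → ℕ}
    (hN : Tendsto (fun L : ℕ => ((L : ℝ) * (∑' n : ℕ, (n : ℝ) * q L n) - N L) / √L)
      atTop (𝓝 0)) :
    Tendsto (fun L : ℕ => 2 * Real.pi * √L * sumWeight (q L) L (N L)) atTop
      (𝓝 √(Real.pi / ((∑' n : ℕ, ((n : ℝ) - ∑' k : ℕ, (k : ℝ) * p k) ^ 2 * p n) / 2))) := by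
  set V := ∑' n : ℕ, ((n : ℝ) - ∑' k : ℕ, (k : ℝ) * p k) ^ 2 * p n with hV
  set m : ℕ → ℝ := fun L => ∑' n : ℕ, (n : ℝ) * q L n with hm
  -- The halving gives room: the masses at 0 and 1 converge to `p 0` and `p 1`, hence eventually
  -- exceed δ.
  set δ : ℝ := min (p 0) (p 1) / 2 with hδ
  have hπ := Real.pi_pos
  have hδ0 : 0 < δ := by
    have := lt_min h.limit.pos_zero h.limit.pos_one
    positivity
  have hδp0 : δ < p 0 := by
    have := min_le_left (p 0) (p 1)
    have := h.limit.pos_zero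
    rw [hδ]; linarith
  have hδp1 : δ < p 1 := by
    have := min_le_right (p 0) (p 1)
    have := h.limit.pos_one
    rw [hδ]; linarith
  -- The substitution t = u/√L produces the factor √L of the statement; the indicator puts the
  -- growing range of u on the whole line, as dominated convergence needs.
  set G : ℕ → ℝ → ℂ := fun L => Set.indicator (Set.Ioc (-Real.pi) Real.pi) fun t =>
    charSum (q L) t ^ L * Complex.exp (-(t * N L * Complex.I)) with hG
  have hlim : Tendsto (fun L : ℕ => ∫ u : ℝ, G L (u / √L)) atTop
      (𝓝 (∫ u : ℝ, ((Real.exp (-(V / 2) * u ^ 2) : ℝ) : ℂ))) := by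
    refine tendsto_integral_filter_of_dominated_convergence
      (fun u => Real.exp (-(δ / Real.pi ^ 2) * u ^ 2)) ?_ ?_
      (integrable_exp_neg_mul_sq (by positivity)) ?_
    · filter_upwards [h.hasSum] with L hL
      refine Measurable.aestronglyMeasurable ?_
      have hc : Measurable (charSum (q L)) := by
        refine Continuous.measurable ?_
        refine continuous_tsum (u := q L) (fun n => by fun_prop) hL.summable fun n t => ?_
        rw [norm_mul_exp_nat _ _ (h.nonneg L n)]
      have : Measurable (G L) := by
        refine Measurable.indicator ?_ measurableSet_Ioc
        fun_prop
      exact this.comp (by fun_prop)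
    · filter_upwards [h.hasSum, (h.lim 0).eventually_const_le hδp0,
        (h.lim 1).eventually_const_le hδp1, eventually_gt_atTop 0] with L hL h0 h1 hLpos
      refine Eventually.of_forall fun u => ?_
      have hL' : (0 : ℝ) < L := by exact_mod_cast hLpos
      simp only [hG, Set.indicator]
      split_ifs with hu
      · rw [norm_mul, norm_pow,
          show -(((u / √L : ℝ) : ℂ) * (N L : ℂ) * Complex.I)
            = ((-(u / √L * N L) : ℝ) : ℂ) * Complex.I by push_cast; ring,
          Complex.norm_exp_ofReal_mul_I, mul_one]
        have := norm_charSum_le (h.nonneg L) hL hδ0.le h0 h1 (abs_le.mpr ⟨hu.1.le, hu.2⟩)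
        refine (pow_le_pow_left₀ (norm_nonneg _) this L).trans (le_of_eq ?_)
        rw [← Real.exp_nat_mul, div_pow, Real.sq_sqrt hL'.le]
        congr 1
        field_simp
      · rw [norm_zero]
        positivity
    · refine Eventually.of_forall fun u => ?_
      have hpow := Complex.tendsto_one_add_pow_exp_of_tendsto (h.tendsto_centered u)
      -- The mismatch between N and L times the mean is o(√L), so the phase left after centring
      -- tends to 1.
      have hphase : Tendsto (fun L : ℕ => Complex.exp (((u * (((L : ℝ) * m L - N L) / √L) : ℝ) : ℂ)
          * Complex.I)) atTop (𝓝 1) := by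
        have h1 : Tendsto (fun L : ℕ => ((u * (((L : ℝ) * m L - N L) / √L) : ℝ) : ℂ)
            * Complex.I) atTop (𝓝 ((u * 0 : ℝ) * Complex.I)) :=
          ((Complex.continuous_ofReal.tendsto _).comp (hN.const_mul u)).mul_const _
        have := (Complex.continuous_exp.tendsto _).comp h1
        simpa [Function.comp_def] using this
      have hmul := hpow.mul hphase
      rw [mul_one, ← Complex.ofReal_exp] at hmul
      rw [show -(V / 2) * u ^ 2 = -(u ^ 2 * V) / 2 by ring]
      refine hmul.congr' ?_
      have hsq : Tendsto (fun L : ℕ => √(L : ℝ)) atTop atTop :=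
        Real.tendsto_sqrt_atTop.comp tendsto_natCast_atTop_atTop
      have hu0 : Tendsto (fun L : ℕ => u / √(L : ℝ)) atTop (𝓝 0) := hsq.const_div_atTop u
      filter_upwards [hu0.eventually (Ioc_mem_nhds (neg_lt_zero.mpr hπ) hπ),
        eventually_gt_atTop 0] with L hL hLpos
      have hL' : (0 : ℝ) < L := by exact_mod_cast hLpos
      have hmem : u / √(L : ℝ) ∈ Set.Ioc (-Real.pi) Real.pi := hL
      simp only [hG]
      rw [Set.indicator_of_mem hmem, add_sub_cancel, mul_pow, ← Complex.exp_nat_mul]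
      rw [mul_right_comm, ← Complex.exp_add, mul_comm]
      congr 2
      have hs : ((√L : ℝ) : ℂ) ≠ 0 := by
        exact_mod_cast (Real.sqrt_pos.mpr hL').ne'
      rw [show (∑' n : ℕ, (n : ℝ) * q L n) = m L from rfl]
      push_cast
      field_simp
      ring
  have hgauss : (∫ u : ℝ, ((Real.exp (-(V / 2) * u ^ 2) : ℝ) : ℂ))
      = ((√(Real.pi / (V / 2)) : ℝ) : ℂ) := by
    rw [integral_complex_ofReal, integral_gaussian]
  rw [hgauss] at hlim
  have hre := (Complex.continuous_re.tendsto _).comp hlim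
  rw [Complex.ofReal_re] at hre
  refine hre.congr' ?_
  filter_upwards [h.hasSum] with L hL
  have hF := sumWeight_eq_integral (h.nonneg L) hL.summable L (N L)
  rw [intervalIntegral.integral_of_le (by linarith), ← integral_indicator measurableSet_Ioc] at hF
  simp only [Function.comp]
  rw [Measure.integral_comp_div (G L) √L, hG]
  simp only
  rw [← hF, abs_of_nonneg (Real.sqrt_nonneg _), Complex.real_smul, ← Complex.ofReal_mul,
    Complex.ofReal_re]
  ring

end DominatedArray

/-! ### Truncation under conditioning on the particle number -/

namespace FiniteVarianceLaw

variable {p : ℕ → ℝ}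

lemma tendsto_tsum_of_le (h : FiniteVarianceLaw p) {f : ℕ → ℕ → ℝ} (hf0 : ∀ L n, 0 ≤ f L n)
    (hfp : ∀ᶠ L in atTop, ∀ n, f L n ≤ p n)
    (hlim : ∀ n, Tendsto (fun L => f L n) atTop (𝓝 (p n))) :
    Tendsto (fun L => ∑' n, f L n) atTop (𝓝 1) := by
  rw [← h.hasSum.tsum_eq]
  refine tendsto_tsum_of_dominated_convergence h.hasSum.summable hlim ?_
  filter_upwards [hfp] with L hL n
  rw [Real.norm_of_nonneg (hf0 L n)]
  exact hL n

lemma dominatedArray_normalize (h : FiniteVarianceLaw p) {f : ℕ → ℕ → ℝ}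
    (hf0 : ∀ L n, 0 ≤ f L n) (hfp : ∀ᶠ L in atTop, ∀ n, f L n ≤ p n)
    (hlim : ∀ n, Tendsto (fun L => f L n) atTop (𝓝 (p n))) :
    DominatedArray p fun L n => (∑' k, f L k)⁻¹ * f L n where
  nonneg L n := mul_nonneg (inv_nonneg.mpr (tsum_nonneg (hf0 L))) (hf0 L n)
  hasSum := by
    filter_upwards [hfp, (h.tendsto_tsum_of_le hf0 hfp hlim).eventually_const_lt zero_lt_one]
      with L hL hZ
    have := (Summable.of_nonneg_of_le (hf0 L) hL h.hasSum.summable).hasSum.mul_left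
      (∑' k, f L k)⁻¹
    rwa [inv_mul_cancel₀ hZ.ne'] at this
  dom := by
    -- The total mass tends to 1, hence eventually exceeds 1/2, and its inverse is then at most 2.
    refine ⟨2, zero_le_two, ?_⟩
    filter_upwards [hfp, (h.tendsto_tsum_of_le hf0 hfp hlim).eventually_const_lt one_half_lt_one]
      with L hL hZ n
    refine mul_le_mul ?_ (hL n) (hf0 L n) zero_le_two
    rw [inv_le_comm₀ (by linarith) two_pos]
    linarith
  lim n := by
    simpa using ((h.tendsto_tsum_of_le hf0 hfp hlim).inv₀ one_ne_zero).mul (hlim n)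
  limit := h

/-- Conditionally on the number of particles, the probability that no occupation number exceeds
`K L` converges to `e^{-τ}`, provided that `L` times the tail of the tilted law converges
to `τ`. -/
theorem tendsto_sumWeight_ratio (h : FiniteVarianceLaw p) {s K : ℕ → ℝ} {N : ℕ → ℕ} {τ : ℝ}
    (hs : Tendsto s atTop (𝓝 0)) (hs0 : ∀ᶠ L in atTop, 0 ≤ s L) (hK : Tendsto K atTop atTop)
    (hmean : ∀ᶠ L : ℕ in atTop, (L : ℝ) * ∑' n : ℕ, (n : ℝ) * (p n * Real.exp (-(s L * n)))
      = N L * ∑' n : ℕ, p n * Real.exp (-(s L * n)))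
    (htail : Tendsto (fun L : ℕ => (L : ℝ) *
      ∑' n : ℕ, if K L < n then p n * Real.exp (-(s L * n)) else 0) atTop (𝓝 τ))
    (hmom : Tendsto (fun L : ℕ => √(L : ℝ) *
      ∑' n : ℕ, if K L < n then (n * p n) * Real.exp (-(s L * n)) else 0) atTop (𝓝 0)) :
    Tendsto (fun L : ℕ => sumWeight (fun n => if (n : ℝ) ≤ K L then p n else 0) L (N L)
      / sumWeight p L (N L)) atTop (𝓝 (Real.exp (-τ))) := by
  set f : ℕ → ℕ → ℝ := fun L n => p n * Real.exp (-(s L * n)) with hf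
  set g : ℕ → ℕ → ℝ := fun L n => if (n : ℝ) ≤ K L then f L n else 0 with hg
  -- `T` and `e` are the mass and the first moment that truncation removes from the tilted weights
  -- `f`.
  set T : ℕ → ℝ := fun L => ∑' n : ℕ, if K L < n then f L n else 0 with hT
  set e : ℕ → ℝ := fun L => ∑' n : ℕ, if K L < n then (n * p n) * Real.exp (-(s L * n)) else 0
    with he
  have hf0 : ∀ L n, 0 ≤ f L n := fun L n => mul_nonneg (h.nonneg n) (Real.exp_pos _).le
  have hg0 : ∀ L n, 0 ≤ g L n := fun L n => by
    simp only [hg]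
    split_ifs
    exacts [hf0 L n, le_rfl]
  have hgf : ∀ L n, g L n ≤ f L n := fun L n => by
    simp only [hg]
    split_ifs
    exacts [le_rfl, hf0 L n]
  have hfp : ∀ᶠ L in atTop, ∀ n, f L n ≤ p n := by
    filter_upwards [hs0] with L hL n
    refine mul_le_of_le_one_right (h.nonneg n) (Real.exp_le_one_iff.mpr ?_)
    have := mul_nonneg hL n.cast_nonneg
    linarith
  have hgp : ∀ᶠ L in atTop, ∀ n, g L n ≤ p n := by
    filter_upwards [hfp] with L hL n
    exact (hgf L n).trans (hL n)
  have hflim : ∀ n, Tendsto (fun L => f L n) atTop (𝓝 (p n)) := by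
    intro n
    have h1 : Tendsto (fun L => -(s L * n)) atTop (𝓝 0) := by
      simpa using (hs.mul_const (n : ℝ)).neg
    have := ((Real.continuous_exp.tendsto 0).comp h1).const_mul (p n)
    simpa [Function.comp_def] using this
  have hglim : ∀ n, Tendsto (fun L => g L n) atTop (𝓝 (p n)) := by
    intro n
    refine (hflim n).congr' ?_
    filter_upwards [hK.eventually_ge_atTop (n : ℝ)] with L hL
    simp only [hg, if_pos hL]
  have hZf := h.tendsto_tsum_of_le hf0 hfp hflim
  have hZg := h.tendsto_tsum_of_le hg0 hgp hglim
  set Z : ℕ → ℝ := fun L => ∑' n, f L n with hZ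
  set W : ℕ → ℝ := fun L => ∑' n, g L n with hW
  have hA := h.dominatedArray_normalize hf0 hfp hflim
  have hB := h.dominatedArray_normalize hg0 hgp hglim
  have hfs : ∀ᶠ L in atTop, Summable (f L) := by
    filter_upwards [hfp] with L hL
    exact Summable.of_nonneg_of_le (hf0 L) hL h.hasSum.summable
  have hnfs : ∀ᶠ L in atTop, Summable fun n : ℕ => (n : ℝ) * f L n := by
    filter_upwards [hfp] with L hL
    exact Summable.of_nonneg_of_le (fun n => mul_nonneg n.cast_nonneg (hf0 L n))
      (fun n => mul_le_mul_of_nonneg_left (hL n) n.cast_nonneg) h.summable_mean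
  have hWZ : ∀ᶠ L in atTop, W L = Z L - T L := by
    filter_upwards [hfs] with L hL
    have hTs : Summable fun n : ℕ => if K L < n then f L n else 0 :=
      Summable.of_nonneg_of_le (fun n => by split_ifs; exacts [hf0 L n, le_rfl])
        (fun n => by split_ifs; exacts [le_rfl, hf0 L n]) hL
    rw [hW, hZ, hT]
    simp only
    rw [← hL.tsum_sub hTs]
    refine tsum_congr fun n => ?_
    simp only [hg]
    by_cases hn : (n : ℝ) ≤ K L
    · simp [hn, not_lt.mpr hn]
    · simp [hn, not_le.mp hn]
  have hmeanW : ∀ᶠ L in atTop, ∑' n : ℕ, (n : ℝ) * g L n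
      = (∑' n : ℕ, (n : ℝ) * f L n) - e L := by
    filter_upwards [hnfs] with L hL
    have hTs : Summable fun n : ℕ => if K L < n then (n * p n) * Real.exp (-(s L * n)) else 0 := by
      refine Summable.of_nonneg_of_le (fun n => ?_) (fun n => ?_) hL
      · split_ifs
        exacts [mul_nonneg (mul_nonneg n.cast_nonneg (h.nonneg n)) (Real.exp_pos _).le, le_rfl]
      · split_ifs
        · exact le_of_eq (mul_assoc _ _ _)
        · exact mul_nonneg n.cast_nonneg (hf0 L n)
    rw [he]
    simp only
    rw [← hL.tsum_sub hTs]
    refine tsum_congr fun n => ?_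
    simp only [hg, hf]
    by_cases hn : (n : ℝ) ≤ K L
    · simp [hn, not_lt.mpr hn]
    · simp [hn, not_le.mp hn, mul_assoc]
  have hsq : Tendsto (fun L : ℕ => √(L : ℝ)) atTop atTop :=
    Real.tendsto_sqrt_atTop.comp tendsto_natCast_atTop_atTop
  have hZpos := hZf.eventually_const_lt zero_lt_one
  have hWpos := hZg.eventually_const_lt zero_lt_one
  have hmeanf : ∀ᶠ L : ℕ in atTop, ∑' n : ℕ, (n : ℝ) * ((Z L)⁻¹ * f L n) = N L / L := by
    filter_upwards [hmean, hZpos, eventually_gt_atTop 0] with L hL hZL hLpos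
    have hL' : (0 : ℝ) < L := by exact_mod_cast hLpos
    have : ∀ n : ℕ, (n : ℝ) * ((Z L)⁻¹ * f L n) = (Z L)⁻¹ * ((n : ℝ) * f L n) := fun n => by ring
    simp_rw [this]
    rw [tsum_mul_left]
    change (L : ℝ) * (∑' n : ℕ, (n : ℝ) * f L n) = N L * Z L at hL
    have hZ0 : 0 < Z L := hZL
    field_simp
    linarith
  have hdens : Tendsto (fun L : ℕ => (N L : ℝ) / L) atTop (𝓝 (∑' n : ℕ, (n : ℝ) * p n)) :=
    hA.tendsto_mean.congr' hmeanf
  -- The tilted law has mean exactly N/L, so its centring error is zero.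
  have hlimA := hA.local_limit (N := N) (by
    refine tendsto_const_nhds.congr' ?_
    filter_upwards [hmeanf, eventually_gt_atTop 0] with L hL hLpos
    have hL' : (0 : ℝ) < L := by exact_mod_cast hLpos
    change _ = ((L : ℝ) * (∑' n : ℕ, (n : ℝ) * ((Z L)⁻¹ * f L n)) - N L) / √L
    rw [hL, mul_div_cancel₀ _ hL'.ne', sub_self, zero_div])
  -- For the truncated law, L times the mean minus N equals (N T - L e)/W. After division by √L the
  -- first part is (N/L)(L T)/√L, which vanishes because L T converges; the second vanishes by
  -- `hmom`.
  have hlimB := hB.local_limit (N := N) (by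
    have h1 : Tendsto (fun L : ℕ => ((N L : ℝ) / L * (L * T L) / √L - √L * e L) / W L) atTop
        (𝓝 0) := by
      have := (((hdens.mul htail).div_atTop hsq).sub hmom).div hZg one_ne_zero
      rw [sub_zero, zero_div] at this
      exact this
    refine h1.congr' ?_
    filter_upwards [hmean, hmeanW, hWZ, hWpos, eventually_gt_atTop 0] with L h2 h3 h4 h5 hLpos
    have hL' : (0 : ℝ) < L := by exact_mod_cast hLpos
    have : ∀ n : ℕ, (n : ℝ) * ((W L)⁻¹ * g L n) = (W L)⁻¹ * ((n : ℝ) * g L n) := fun n => by ring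
    change _ = ((L : ℝ) * (∑' n : ℕ, (n : ℝ) * ((W L)⁻¹ * g L n)) - N L) / √L
    simp_rw [this]
    rw [tsum_mul_left, h3]
    change (L : ℝ) * (∑' n : ℕ, (n : ℝ) * f L n) = N L * Z L at h2
    have hW0 : 0 < W L := h5
    have hr : √(L : ℝ) * √L = L := Real.mul_self_sqrt hL'.le
    have hr0 : 0 < √(L : ℝ) := Real.sqrt_pos.mpr hL'
    have h6 : (L : ℝ) * ((W L)⁻¹ * ((∑' n : ℕ, (n : ℝ) * f L n) - e L)) - N L
        = (N L * T L - L * e L) / W L := by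
      have h7 : (N L : ℝ) * T L = N L * Z L - N L * W L := by rw [h4]; ring
      rw [h7, ← h2]
      field_simp
      ring
    rw [h6]
    have h8 : (L : ℝ) * e L / √L = √L * e L := by
      rw [div_eq_iff hr0.ne']
      linear_combination (-(e L)) * hr
    rw [← h8]
    field_simp)
  have hVpos : 0 < √(Real.pi / ((∑' n : ℕ, ((n : ℝ) - ∑' k : ℕ, (k : ℝ) * p k) ^ 2 * p n) / 2)) :=
    Real.sqrt_pos.mpr (div_pos Real.pi_pos (half_pos h.variance_pos))
  -- Both arrays converge to the same law `p`, so their Gaussian constants agree and cancel. Only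
  -- (W/Z)^L = (1 - T/Z)^L remains.
  have hratio := hlimB.div hlimA hVpos.ne'
  rw [div_self hVpos.ne'] at hratio
  have hpow : Tendsto (fun L : ℕ => (1 + -(T L / Z L)) ^ L) atTop (𝓝 (Real.exp (-τ))) := by
    refine Real.tendsto_one_add_pow_exp_of_tendsto ?_
    have := (htail.div hZf one_ne_zero).neg
    rw [div_one] at this
    refine this.congr fun L => ?_
    simp only [Pi.div_apply]
    ring
  have hfin := hpow.mul hratio
  rw [mul_one] at hfin
  refine hfin.congr' ?_
  filter_upwards [hZpos, hWpos, hWZ, eventually_gt_atTop 0] with L hZL hWL hWZL hLpos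
  have hL' : (0 : ℝ) < L := by exact_mod_cast hLpos
  have hZ0 : 0 < Z L := hZL
  have hW0 : 0 < W L := hWL
  have h1 : 1 + -(T L / Z L) = W L / Z L := by
    rw [hWZL]
    field_simp
    ring
  have h2 : sumWeight (g L) L (N L) = Real.exp (-(s L * N L)) *
      sumWeight (fun n => if (n : ℝ) ≤ K L then p n else 0) L (N L) := by
    rw [← sumWeight_mul_exp]
    refine sumWeight_congr fun n => ?_
    simp only [hg, hf]
    split_ifs <;> simp
  have h3 : sumWeight (f L) L (N L) = Real.exp (-(s L * N L)) * sumWeight p L (N L) :=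
    sumWeight_mul_exp _ _ _ _
  have hr0 : 0 < √(L : ℝ) := Real.sqrt_pos.mpr hL'
  have hE := Real.exp_pos (-(s L * N L))
  simp only [Pi.div_apply]
  rw [h1]
  change (W L / Z L) ^ L * (2 * Real.pi * √L * sumWeight (fun n => (W L)⁻¹ * g L n) L (N L) /
    (2 * Real.pi * √L * sumWeight (fun n => (Z L)⁻¹ * f L n) L (N L))) = _
  rw [sumWeight_const_mul, sumWeight_const_mul, h2, h3, mul_div_mul_left _ _ (by positivity),
    div_pow, inv_pow, inv_pow]
  -- If the conditioning event has weight zero, both quotients are zero by the convention for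
  -- division.
  rcases eq_or_ne (sumWeight p L (N L)) 0 with h0 | h0
  · simp [h0]
  · field_simp

end FiniteVarianceLaw

/-! ### Exponential tilts and their asymptotics -/

open Asymptotics

lemma mul_exp_neg_le {a s : ℝ} (ha : 0 ≤ a) (hs : 0 ≤ s) (n : ℕ) :
    a * Real.exp (-(s * n)) ≤ a := by
  refine mul_le_of_le_one_right ha (Real.exp_le_one_iff.mpr ?_)
  have := mul_nonneg hs n.cast_nonneg
  linarith

lemma summable_mul_exp_neg {f : ℕ → ℝ} (hf : ∀ n, 0 ≤ f n) (hs : Summable f) {s : ℝ} (h : 0 ≤ s) :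
    Summable fun n : ℕ => f n * Real.exp (-(s * n)) :=
  Summable.of_nonneg_of_le (fun n => mul_nonneg (hf n) (Real.exp_pos _).le)
    (fun n => mul_exp_neg_le (hf n) h n) hs

lemma continuousOn_tsum_mul_exp_neg {f : ℕ → ℝ} (hf : ∀ n, 0 ≤ f n) (hs : Summable f) :
    ContinuousOn (fun s : ℝ => ∑' n : ℕ, f n * Real.exp (-(s * n))) (Set.Ici 0) := by
  refine continuousOn_tsum (u := f) (fun n => by fun_prop) hs fun n s hs => ?_
  rw [Real.norm_of_nonneg (mul_nonneg (hf n) (Real.exp_pos _).le)]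
  exact mul_exp_neg_le (hf n) hs n

/-- The derivative is one-sided because a power-law series need not converge for s < 0. Difference
quotients are dominated through |e^{-sn} - 1| ≤ sn. -/
lemma hasDerivWithinAt_tsum_mul_exp_neg {f : ℕ → ℝ} (hf : ∀ n, 0 ≤ f n) (hs : Summable f)
    (hn : Summable fun n : ℕ => (n : ℝ) * f n) :
    HasDerivWithinAt (fun s : ℝ => ∑' n : ℕ, f n * Real.exp (-(s * n)))
      (-∑' n : ℕ, (n : ℝ) * f n) (Set.Ici 0) 0 := by
  rw [hasDerivWithinAt_iff_tendsto_slope]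
  have hlim : Tendsto (fun s : ℝ => ∑' n : ℕ, f n * ((Real.exp (-(s * n)) - 1) / s))
      (𝓝[Set.Ici 0 \ {0}] 0) (𝓝 (∑' n : ℕ, f n * -(n : ℝ))) := by
    refine tendsto_tsum_of_dominated_convergence hn (fun n => ?_) ?_
    · have hd : HasDerivAt (fun s : ℝ => Real.exp (-(s * n))) (-(n : ℝ)) 0 := by
        have h1 : HasDerivAt (fun s : ℝ => -(s * n)) (-(1 * n : ℝ)) 0 :=
          ((hasDerivAt_id (0 : ℝ)).mul_const (n : ℝ)).neg
        simpa using h1.exp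
      have := (hasDerivWithinAt_iff_tendsto_slope (s := Set.Ici 0)).mp hd.hasDerivWithinAt
      refine (this.const_mul (f n)).congr fun s => ?_
      rw [slope_def_field]
      simp
    · filter_upwards [self_mem_nhdsWithin] with s hs n
      have hs0 : 0 < s := lt_of_le_of_ne hs.1 (Ne.symm hs.2)
      have h1 : Real.exp (-(s * n)) ≤ 1 := by
        rw [Real.exp_le_one_iff]
        have := mul_nonneg hs0.le n.cast_nonneg
        linarith
      have h2 := Real.add_one_le_exp (-(s * n))
      rw [norm_mul, Real.norm_of_nonneg (hf n), norm_div, Real.norm_of_nonneg hs0.le,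
        Real.norm_of_nonpos (by linarith), mul_comm]
      refine mul_le_mul_of_nonneg_right ?_ (hf n)
      rw [div_le_iff₀ hs0]
      linarith
  have hval : ∑' n : ℕ, f n * -(n : ℝ) = -∑' n : ℕ, (n : ℝ) * f n := by
    rw [← tsum_neg]
    exact tsum_congr fun n => by ring
  rw [hval] at hlim
  refine hlim.congr' ?_
  filter_upwards [self_mem_nhdsWithin] with s hs0
  have h1 := (summable_mul_exp_neg hf hs hs0.1).hasSum.sub
    (summable_mul_exp_neg hf hs le_rfl).hasSum
  rw [slope_def_field, ← h1.tsum_eq, sub_zero, ← tsum_div_const]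
  refine tsum_congr fun n => ?_
  rw [zero_mul, neg_zero, Real.exp_zero]
  ring

namespace FiniteVarianceLaw

variable {p : ℕ → ℝ}

lemma variance_eq (h : FiniteVarianceLaw p) :
    ∑' n : ℕ, ((n : ℝ) - ∑' k : ℕ, (k : ℝ) * p k) ^ 2 * p n
      = (∑' n : ℕ, (n : ℝ) ^ 2 * p n) - (∑' k : ℕ, (k : ℝ) * p k) ^ 2 := by
  set ρ := ∑' k : ℕ, (k : ℝ) * p k with hρ
  have := ((h.summable_sq.hasSum.sub (h.summable_mean.hasSum.mul_left (2 * ρ))).add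
    (h.hasSum.mul_left (ρ ^ 2))).tsum_eq
  rw [← hρ] at this
  rw [show (∑' n : ℕ, (n : ℝ) ^ 2 * p n) - ρ ^ 2
    = (∑' n : ℕ, (n : ℝ) ^ 2 * p n) - 2 * ρ * ρ + ρ ^ 2 * 1 by ring, ← this]
  exact tsum_congr fun n => by ring

/-- Existence of exponential tilts lowering the mean of `p` by a prescribed small amount, and their
asymptotics. -/
theorem exists_tilt (h : FiniteVarianceLaw p) {d : ℕ → ℝ} (hd : Tendsto d atTop (𝓝 0))
    (hd0 : ∀ᶠ L in atTop, 0 ≤ d L) :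
    ∃ s : ℕ → ℝ, (∀ᶠ L in atTop, 0 ≤ s L) ∧ Tendsto s atTop (𝓝 0) ∧
      (∀ᶠ L in atTop, ∑' n : ℕ, (n : ℝ) * (p n * Real.exp (-(s L * n)))
        = ((∑' k : ℕ, (k : ℝ) * p k) - d L) * ∑' n : ℕ, p n * Real.exp (-(s L * n))) ∧
      s ~[atTop] fun L => d L / ((∑' n : ℕ, (n : ℝ) ^ 2 * p n) - (∑' k : ℕ, (k : ℝ) * p k) ^ 2) := by
  set ρ := ∑' k : ℕ, (k : ℝ) * p k with hρ
  set V := (∑' n : ℕ, (n : ℝ) ^ 2 * p n) - ρ ^ 2 with hV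
  have hVpos : 0 < V := by
    rw [hV, hρ, ← h.variance_eq]
    exact h.variance_pos
  have hn0 : ∀ n : ℕ, 0 ≤ (n : ℝ) * p n := fun n => mul_nonneg n.cast_nonneg (h.nonneg n)
  have hps := h.hasSum.summable
  set F : ℝ → ℝ := fun s => ∑' n : ℕ, p n * Real.exp (-(s * n)) with hF
  set M : ℝ → ℝ := fun s => ∑' n : ℕ, ((n : ℝ) * p n) * Real.exp (-(s * n)) with hM
  have hFc : ContinuousOn F (Set.Ici 0) := continuousOn_tsum_mul_exp_neg h.nonneg hps
  have hMc : ContinuousOn M (Set.Ici 0) := continuousOn_tsum_mul_exp_neg hn0 h.summable_mean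
  have hF0 : F 0 = 1 := by simp [hF, h.hasSum.tsum_eq]
  have hM0 : M 0 = ρ := by simp [hM, hρ]
  have hF1 : ∀ s, 0 ≤ s → F s ≤ 1 := by
    intro s hs
    rw [← h.hasSum.tsum_eq]
    exact (summable_mul_exp_neg h.nonneg hps hs).tsum_le_tsum
      (fun n => mul_exp_neg_le (h.nonneg n) hs n) hps
  -- The tilted mean is M/F, so mean ρ - d means H = d F. Here H vanishes at 0 with right derivative
  -- ρ(-ρ) + ∑ n² p(n) = V.
  set H : ℝ → ℝ := fun s => ρ * F s - M s with hH
  have hHd : HasDerivWithinAt H V (Set.Ici 0) 0 := by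
    have h1 := hasDerivWithinAt_tsum_mul_exp_neg h.nonneg hps h.summable_mean
    have h2 := hasDerivWithinAt_tsum_mul_exp_neg hn0 h.summable_mean
      (h.summable_sq.congr fun n => by ring)
    have h3 := (h1.const_mul ρ).sub h2
    refine h3.congr_deriv ?_
    have : ∑' n : ℕ, (n : ℝ) * ((n : ℝ) * p n) = ∑' n : ℕ, (n : ℝ) ^ 2 * p n :=
      tsum_congr fun n => by ring
    rw [this, ← hρ, hV]
    ring
  have hH0 : H 0 = 0 := by simp [hH, hF0, hM0]
  have hHo : (fun s => H s - V * s) =o[𝓝[Set.Ici 0] 0] fun s => s := by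
    have := hHd.isLittleO
    simpa [hH0, mul_comm] using this
  have hHlb : ∀ᶠ s in 𝓝[Set.Ici 0] (0 : ℝ), V / 2 * s ≤ H s := by
    filter_upwards [hHo.bound (half_pos hVpos), self_mem_nhdsWithin] with s hs hs0
    have hs0' : (0 : ℝ) ≤ s := hs0
    rw [Real.norm_of_nonneg hs0', Real.norm_eq_abs] at hs
    linarith [(abs_le.mp hs).1]
  have hd' : Tendsto (fun L => 2 / V * d L) atTop (𝓝[Set.Ici 0] 0) := by
    refine tendsto_nhdsWithin_iff.mpr ⟨by simpa using hd.const_mul (2 / V), ?_⟩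
    filter_upwards [hd0] with L hL
    exact mul_nonneg (by positivity) hL
  -- Near 0, H(s) ≥ V s/2, so at s = 2d/V already H ≥ d ≥ d F. The intermediate value theorem then
  -- locates s in [0, 2d/V], which also forces s → 0.
  have hex : ∀ᶠ L in atTop, ∃ s, 0 ≤ s ∧ s ≤ 2 / V * d L ∧ H s = d L * F s := by
    filter_upwards [hd0, hd'.eventually hHlb] with L hL hlb
    have hb0 : 0 ≤ 2 / V * d L := mul_nonneg (by positivity) hL
    have hsub : Set.Icc 0 (2 / V * d L) ⊆ Set.Ici 0 := fun s hs => hs.1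
    have hc : ContinuousOn (fun s => H s - d L * F s) (Set.Icc 0 (2 / V * d L)) :=
      (((hFc.const_mul ρ).sub hMc).sub (hFc.const_mul (d L))).mono hsub
    have hmem : (0 : ℝ) ∈ Set.Icc (H 0 - d L * F 0)
        (H (2 / V * d L) - d L * F (2 / V * d L)) := by
      rw [hH0, hF0]
      refine ⟨by linarith, ?_⟩
      have h1 : V / 2 * (2 / V * d L) = d L := by field_simp
      rw [h1] at hlb
      have h2 := mul_le_mul_of_nonneg_left (hF1 _ hb0) hL
      linarith
    obtain ⟨s, hs, hs2⟩ := intermediate_value_Icc hb0 hc hmem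
    exact ⟨s, hs.1, hs.2, by linarith [show H s - d L * F s = 0 from hs2]⟩
  obtain ⟨s, hs⟩ := hex.choice
  have hs0 : ∀ᶠ L in atTop, 0 ≤ s L := hs.mono fun L hL => hL.1
  have hst : Tendsto s atTop (𝓝 0) := by
    refine tendsto_of_tendsto_of_tendsto_of_le_of_le' tendsto_const_nhds
      (tendsto_nhds_of_tendsto_nhdsWithin hd') hs0 (hs.mono fun L hL => hL.2.1)
  have hst' : Tendsto s atTop (𝓝[Set.Ici 0] 0) := tendsto_nhdsWithin_iff.mpr ⟨hst, hs0⟩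
  refine ⟨s, hs0, hst, ?_, ?_⟩
  · filter_upwards [hs] with L hL
    have h1 : ρ * F (s L) - M (s L) = d L * F (s L) := hL.2.2
    have h2 : ∑' n : ℕ, (n : ℝ) * (p n * Real.exp (-(s L * n))) = M (s L) :=
      tsum_congr fun n => by ring
    rw [h2, show ∑' n : ℕ, p n * Real.exp (-(s L * n)) = F (s L) from rfl]
    linarith
  · have hF1t : Tendsto (fun L => F (s L)) atTop (𝓝 1) := by
      rw [← hF0]
      exact ((hFc 0 Set.self_mem_Ici).tendsto).comp hst'
    -- Since H(s) = d F(s) with H(s) ~ V s and F(s) → 1, it follows that s ~ d/V.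
    have h1 : (fun L => H (s L)) ~[atTop] fun L => V * s L := by
      have : (fun L => H (s L) - V * s L) =o[atTop] s := hHo.comp_tendsto hst'
      exact this.trans_isBigO (isBigO_self_const_mul hVpos.ne' _ _)
    have h2 : (fun L => F (s L)) ~[atTop] fun _ => (1 : ℝ) :=
      (isEquivalent_const_iff_tendsto one_ne_zero).mpr hF1t
    have h3 := (h1.div h2).div (IsEquivalent.refl (u := fun _ : ℕ => V))
    symm
    refine (h3.congr_left ?_).congr_right ?_
    · have hFpos := hF1t.eventually_const_lt zero_lt_one
      filter_upwards [hs, hFpos] with L hL hp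
      simp only [Pi.div_apply]
      rw [hL.2.2, mul_div_cancel_right₀ _ hp.ne']
    · refine Eventually.of_forall fun L => ?_
      simp only [Pi.div_apply, div_one]
      field_simp

end FiniteVarianceLaw

/-! ### Tail sums of regularly varying sequences -/

/-- The integrand is the step function equal to a(n+1) on (n, n+1] and to a(0) = 0 on the
nonpositive axis. As an integral, the sum can be rescaled and treated by dominated convergence on a
fixed space. -/
lemma tsum_eq_integral_ceil {a : ℕ → ℝ} (h0 : a 0 = 0) (hs : Summable a) :
    ∑' n, a n = ∫ t : ℝ, a ⌈t⌉₊ := by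
  have hceil : ∀ n : ℕ, ∀ t ∈ Set.Ioc (n : ℝ) (n + 1), ⌈t⌉₊ = n + 1 := by
    intro n t ht
    rw [Nat.ceil_eq_iff (Nat.succ_ne_zero n)]
    simpa using ht
  have hint : ∀ n : ℕ, ∀ F : ℕ → ℝ, ∫ t in Set.Ioc (n : ℝ) (n + 1), F ⌈t⌉₊ = F (n + 1) := by
    intro n F
    rw [setIntegral_congr_fun measurableSet_Ioc
      (fun t ht => congrArg F (hceil n t ht) : Set.EqOn (fun t : ℝ => F ⌈t⌉₊) (fun _ => F (n + 1)) _)]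
    simp
  have hU : (⋃ n : ℕ, Set.Ioc (n : ℝ) (n + 1)) = Set.Ioi 0 := by
    ext t
    simp only [Set.mem_iUnion, Set.mem_Ioi]
    constructor
    · rintro ⟨n, hn⟩
      exact n.cast_nonneg.trans_lt hn.1
    · intro ht
      obtain ⟨m, hm⟩ := Nat.exists_eq_succ_of_ne_zero (Nat.ceil_pos.mpr ht).ne'
      refine ⟨m, ?_⟩
      have := (Nat.ceil_eq_iff (Nat.succ_ne_zero m)).mp hm
      simpa using this
  have hdisj : Pairwise (Function.onFun Disjoint fun n : ℕ => Set.Ioc (n : ℝ) (n + 1)) := by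
    intro m n hmn
    rw [Function.onFun, Set.disjoint_left]
    intro t h1 h2
    have := (hceil m t h1).symm.trans (hceil n t h2)
    omega
  have hio : IntegrableOn (fun t : ℝ => a ⌈t⌉₊) (⋃ n : ℕ, Set.Ioc (n : ℝ) (n + 1)) := by
    refine integrableOn_iUnion_of_summable_integral_norm (fun n => ?_) ?_
    · exact (integrableOn_congr_fun (fun t ht => congrArg a (hceil n t ht) :
        Set.EqOn (fun t : ℝ => a ⌈t⌉₊) (fun _ => a (n + 1)) _) measurableSet_Ioc).mpr
        (integrableOn_const (by simp))
    · refine ((summable_nat_add_iff 1).mpr hs.norm).congr fun n => ?_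
      exact (hint n fun k => ‖a k‖).symm
  have h1 := hasSum_integral_iUnion (fun n : ℕ => measurableSet_Ioc) hdisj hio
  rw [hU] at h1
  rw [hs.tsum_eq_zero_add, h0, zero_add, ← setIntegral_eq_integral_of_forall_compl_eq_zero
    (s := Set.Ioi 0), ← h1.tsum_eq]
  · exact tsum_congr fun n => (hint n a).symm
  · intro t ht
    rw [Nat.ceil_eq_zero.mpr (not_lt.mp ht), h0]

/-- Used with c = 0 and r the scale of the maximum, and with c = B and r = 1/s in the Gumbel regime.
-/
lemma tsum_eq_integral_ceil_affine {a : ℕ → ℝ} (h0 : a 0 = 0) (hs : Summable a) (c : ℝ) {r : ℝ}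
    (hr : 0 < r) : ∑' n, a n = r * ∫ v : ℝ, a ⌈c + r * v⌉₊ := by
  rw [tsum_eq_integral_ceil h0 hs,
    Measure.integral_comp_mul_left (fun t : ℝ => a ⌈c + t⌉₊) r,
    integral_add_left_eq_self (fun t : ℝ => a ⌈t⌉₊) c, abs_of_pos (inv_pos.mpr hr), smul_eq_mul,
    mul_inv_cancel_left₀ hr.ne']

lemma exists_rpow_mul_le {q : ℕ → ℝ} {β A : ℝ}
    (hq : Tendsto (fun n : ℕ => (n : ℝ) ^ β * q n) atTop (𝓝 A)) :
    ∃ C, 0 ≤ C ∧ ∀ n : ℕ, (n : ℝ) ^ β * q n ≤ C := by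
  obtain ⟨C, hC⟩ := hq.bddAbove_range
  exact ⟨max C 0, le_max_right _ _, fun n => (hC ⟨n, rfl⟩).trans (le_max_left _ _)⟩

lemma summable_ite_tail {q : ℕ → ℝ} (hq0 : ∀ n, 0 ≤ q n) (hqs : Summable q) {s : ℝ} (hs : 0 ≤ s)
    (K c : ℝ) :
    Summable fun n : ℕ => c * if K < n then q n * Real.exp (-(s * n)) else 0 := by
  refine Summable.mul_left _ (Summable.of_nonneg_of_le (fun n => ?_) (fun n => ?_) hqs)
  · split_ifs
    exacts [mul_nonneg (hq0 n) (Real.exp_pos _).le, le_rfl]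
  · split_ifs
    · refine mul_le_of_le_one_right (hq0 n) (Real.exp_le_one_iff.mpr ?_)
      have := mul_nonneg hs n.cast_nonneg
      linarith
    · exact hq0 n

lemma div_rpow_mul_rpow_mul {β y q : ℝ} (hy : 0 < y) {h : ℝ} (hh : 0 ≤ h) :
    (h / y) ^ β * (y ^ β * q) = h ^ β * q := by
  rw [Real.div_rpow hh hy.le]
  have := (Real.rpow_pos_of_pos hy β).ne'
  field_simp

/-- Tail sums of a regularly varying sequence with exponential damping of the same order as the
inverse of the cut-off. -/
theorem tendsto_tail_of_scale {q : ℕ → ℝ} {β A ω x : ℝ} {s r : ℕ → ℝ} (hq0 : ∀ n, 0 ≤ q n)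
    (hqs : Summable q) (hq : Tendsto (fun n : ℕ => (n : ℝ) ^ β * q n) atTop (𝓝 A)) (hβ : 1 < β)
    (hs0 : ∀ᶠ L in atTop, 0 ≤ s L) (hr : Tendsto r atTop atTop)
    (hsr : Tendsto (fun L => s L * r L) atTop (𝓝 ω)) (hx : 0 < x) :
    Tendsto (fun L => r L ^ (β - 1) *
      ∑' n : ℕ, if x * r L < n then q n * Real.exp (-(s L * n)) else 0) atTop
      (𝓝 (A * ∫ t in Set.Ioi x, Real.exp (-(ω * t)) / t ^ β)) := by
  obtain ⟨C, hC0, hC⟩ := exists_rpow_mul_le hq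
  set F : ℕ → ℝ → ℝ := fun L v => r L ^ β * if x * r L < (⌈0 + r L * v⌉₊ : ℝ) then
    q ⌈0 + r L * v⌉₊ * Real.exp (-(s L * ⌈0 + r L * v⌉₊)) else 0 with hF
  have hlim : Tendsto (fun L => ∫ v, F L v) atTop
      (𝓝 (∫ v, Set.indicator (Set.Ioi x) (fun t => A * (Real.exp (-(ω * t)) / t ^ β)) v)) := by
    -- Rounding up can push the index past the cut-off for v slightly below x. Once r ≥ 2/x, passing
    -- the cut-off gives r v > x r - 1 ≥ x r/2, hence the support (x/2, ∞).
    refine tendsto_integral_filter_of_dominated_convergence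
      (Set.indicator (Set.Ioi (x / 2)) fun v => C * v ^ (-β)) ?_ ?_ ?_ ?_
    · refine Eventually.of_forall fun L => Measurable.aestronglyMeasurable ?_
      have h1 : Measurable fun n : ℕ => r L ^ β * if x * r L < (n : ℝ) then
        q n * Real.exp (-(s L * n)) else 0 := measurable_of_countable _
      exact h1.comp (Nat.measurable_ceil.comp (by fun_prop))
    · filter_upwards [hs0, hr.eventually_ge_atTop (2 / x), hr.eventually_gt_atTop 0]
        with L hsL hrL hr0
      refine Eventually.of_forall fun v => ?_
      simp only [hF, zero_add]
      split_ifs with hcut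
      · set n := ⌈r L * v⌉₊ with hn
        have hn0 : (0 : ℝ) < n := (mul_pos hx hr0).trans hcut
        have hrv : 0 < r L * v := by
          have : 0 < n := by exact_mod_cast hn0
          exact Nat.ceil_pos.mp this
        have hlt := Nat.ceil_lt_add_one hrv.le
        have hle := Nat.le_ceil (r L * v)
        rw [← hn] at hlt hle
        have h2 : 2 ≤ r L * x := by rwa [div_le_iff₀ hx] at hrL
        have hv : x / 2 < v := by
          by_contra hcon
          push Not at hcon
          have := mul_le_mul_of_nonneg_left hcon hr0.le
          nlinarith
        have hv0 : 0 < v := (half_pos hx).trans hv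
        rw [Set.indicator_of_mem (show v ∈ Set.Ioi (x / 2) from hv), Real.norm_of_nonneg
          (mul_nonneg (Real.rpow_nonneg hr0.le _) (mul_nonneg (hq0 _) (Real.exp_pos _).le)),
          ← mul_assoc, ← div_rpow_mul_rpow_mul hn0 hr0.le]
        have h3 : (r L / n) ^ β ≤ v ^ (-β) := by
          rw [Real.rpow_neg hv0.le, ← Real.inv_rpow hv0.le]
          refine Real.rpow_le_rpow (by positivity) ?_ (by linarith)
          rw [div_le_iff₀ hn0, inv_mul_eq_div, le_div_iff₀ hv0]
          exact hle
        have h4 : Real.exp (-(s L * n)) ≤ 1 := by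
          rw [Real.exp_le_one_iff]
          have := mul_nonneg hsL hn0.le
          linarith
        have h5 : 0 ≤ (n : ℝ) ^ β * q n := mul_nonneg (by positivity) (hq0 n)
        calc (r L / n) ^ β * ((n : ℝ) ^ β * q n) * Real.exp (-(s L * n))
            ≤ (v ^ (-β) * C) * 1 := by
              gcongr
              exact hC n
          _ = C * v ^ (-β) := by ring
      · rw [mul_zero, norm_zero]
        refine Set.indicator_nonneg (fun v hv => ?_) v
        have : 0 < v := (half_pos hx).trans hv
        positivity
    · rw [integrable_indicator_iff measurableSet_Ioi]
      exact (integrableOn_Ioi_rpow_of_lt (by linarith) (half_pos hx)).const_mul C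
    -- At v = x itself the ceiling may fall on either side of the cut-off; this point is null.
    · have hne : ∀ᵐ v : ℝ, v ≠ x := by simp [ae_iff]
      filter_upwards [hne] with v hv
      rcases lt_or_gt_of_ne hv with hvx | hvx
      · rw [Set.indicator_of_notMem (by simpa using hvx.le)]
        refine tendsto_const_nhds.congr' ?_
        have h1 : Tendsto (fun L => (x - v) * r L) atTop atTop :=
          hr.const_mul_atTop (sub_pos.mpr hvx)
        filter_upwards [h1.eventually_ge_atTop 1, hr.eventually_gt_atTop 0] with L hL hr0
        simp only [hF, zero_add]
        rw [if_neg, mul_zero]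
        rw [not_lt]
        rcases le_or_gt (r L * v) 0 with h2 | h2
        · rw [Nat.ceil_eq_zero.mpr h2]
          simpa using (mul_pos hx hr0).le
        · have := Nat.ceil_lt_add_one h2.le
          nlinarith
      · rw [Set.indicator_of_mem (by simpa using hvx)]
        have hv0 : 0 < v := hx.trans hvx
        have h1 : Tendsto (fun L => (⌈v * r L⌉₊ : ℝ) / r L) atTop (𝓝 v) :=
          (tendsto_nat_ceil_mul_div_atTop hv0.le).comp hr
        have h2 : Tendsto (fun L => ⌈v * r L⌉₊) atTop atTop :=
          tendsto_nat_ceil_atTop.comp (hr.const_mul_atTop hv0)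
        have h3 := (((h1.inv₀ hv0.ne').rpow_const (p := β) (Or.inl (inv_ne_zero hv0.ne'))).mul
          (hq.comp h2)).mul ((Real.continuous_exp.tendsto _).comp (hsr.mul h1).neg)
        have hval : v⁻¹ ^ β * A * Real.exp (-(ω * v)) = A * (Real.exp (-(ω * v)) / v ^ β) := by
          rw [Real.inv_rpow hv0.le]
          ring
        rw [hval] at h3
        refine h3.congr' ?_
        filter_upwards [hr.eventually_gt_atTop 0] with L hr0
        have hn0 : (0 : ℝ) < ⌈v * r L⌉₊ := (mul_pos hv0 hr0).trans_le (Nat.le_ceil _)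
        have hcut : x * r L < ⌈v * r L⌉₊ :=
          (mul_lt_mul_of_pos_right hvx hr0).trans_le (Nat.le_ceil _)
        simp only [hF, zero_add, Function.comp, mul_comm (r L) v]
        rw [if_pos hcut, inv_div, div_rpow_mul_rpow_mul hn0 hr0.le, mul_assoc]
        congr 4
        field_simp
  rw [integral_indicator measurableSet_Ioi, integral_const_mul] at hlim
  refine hlim.congr' ?_
  filter_upwards [hs0, hr.eventually_gt_atTop 0] with L hsL hr0
  have h1 := tsum_eq_integral_ceil_affine
    (a := fun n : ℕ => r L ^ β * if x * r L < n then q n * Real.exp (-(s L * n)) else 0)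
    (by
      have : ¬ x * r L < ((0 : ℕ) : ℝ) := by simpa using (mul_pos hx hr0).le
      rw [if_neg this, mul_zero])
    (summable_ite_tail hq0 hqs hsL _ _) 0 hr0
  rw [tsum_mul_left] at h1
  have h2 : ∫ v, F L v = (r L)⁻¹ * (r L * ∫ v, F L v) := by
    rw [inv_mul_cancel_left₀ hr0.ne']
  rw [h2, ← h1, ← mul_assoc, Real.rpow_sub hr0, Real.rpow_one]
  ring

/-- Tail sums of a regularly varying sequence with exponential damping, when the cut-off `B` is
large compared with the inverse of the damping rate `s`. -/
theorem tendsto_tail_of_damped {q : ℕ → ℝ} {β A : ℝ} {s B : ℕ → ℝ} (hq0 : ∀ n, 0 ≤ q n)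
    (hqs : Summable q) (hq : Tendsto (fun n : ℕ => (n : ℝ) ^ β * q n) atTop (𝓝 A)) (hβ : 0 < β)
    (hs0 : ∀ᶠ L in atTop, 0 < s L) (hs : Tendsto s atTop (𝓝 0)) (hB : Tendsto B atTop atTop)
    (hBs : Tendsto (fun L => B L * s L) atTop atTop) (x : ℝ) :
    Tendsto (fun L => s L * B L ^ β * Real.exp (s L * B L) *
      ∑' n : ℕ, if B L + x / s L < n then q n * Real.exp (-(s L * n)) else 0) atTop
      (𝓝 (A * Real.exp (-x))) := by
  obtain ⟨C, hC0, hC⟩ := exists_rpow_mul_le hq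
  set n : ℕ → ℝ → ℕ := fun L v => ⌈B L + (s L)⁻¹ * v⌉₊ with hn
  set F : ℕ → ℝ → ℝ := fun L v => (B L ^ β * Real.exp (s L * B L)) *
    if B L + x / s L < (n L v : ℝ) then q (n L v) * Real.exp (-(s L * n L v)) else 0 with hF
  have hpos : ∀ v : ℝ, ∀ᶠ L in atTop, B L / 2 < B L + (s L)⁻¹ * v := by
    intro v
    filter_upwards [hs0, hBs.eventually_gt_atTop (-2 * v)] with L hsL hL
    have h1 : (s L)⁻¹ * v = v / s L := by rw [inv_mul_eq_div]
    have h2 : -(B L / 2) < v / s L := by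
      rw [lt_div_iff₀ hsL]
      linarith
    linarith
  have hlim : Tendsto (fun L => ∫ v, F L v) atTop
      (𝓝 (∫ v, Set.indicator (Set.Ioi x) (fun t => A * Real.exp (-t)) v)) := by
    -- Rounding shifts v by less than s < 1, hence the support (x - 1, ∞). The constant 2^β appears
    -- because indices beyond the cut-off eventually exceed B/2.
    refine tendsto_integral_filter_of_dominated_convergence
      (Set.indicator (Set.Ioi (x - 1)) fun v => (2 ^ β * C) * Real.exp (-v)) ?_ ?_ ?_ ?_
    · refine Eventually.of_forall fun L => Measurable.aestronglyMeasurable ?_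
      have h1 : Measurable fun k : ℕ => (B L ^ β * Real.exp (s L * B L)) *
        if B L + x / s L < (k : ℝ) then q k * Real.exp (-(s L * k)) else 0 :=
        measurable_of_countable _
      exact h1.comp (Nat.measurable_ceil.comp (by fun_prop))
    · filter_upwards [hs0, hs.eventually_lt_const zero_lt_one, hB.eventually_gt_atTop 0, hpos x]
        with L hsL hs1 hB0 hx2
      refine Eventually.of_forall fun v => ?_
      simp only [hF]
      split_ifs with hcut
      · have hxs : (s L)⁻¹ * x = x / s L := by rw [inv_mul_eq_div]
        have hn2 : B L / 2 < n L v := by linarith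
        have hn0 : (0 : ℝ) < n L v := by linarith
        have harg : 0 < B L + (s L)⁻¹ * v := by
          have : 0 < n L v := by exact_mod_cast hn0
          exact Nat.ceil_pos.mp this
        have hlt : (n L v : ℝ) < B L + (s L)⁻¹ * v + 1 := Nat.ceil_lt_add_one harg.le
        have hle : B L + (s L)⁻¹ * v ≤ n L v := Nat.le_ceil _
        have hsi : s L * (s L)⁻¹ = 1 := mul_inv_cancel₀ hsL.ne'
        have hv : x - 1 < v := by
          have h1 : (s L)⁻¹ * x < (s L)⁻¹ * v + 1 := by linarith
          have h2 := mul_lt_mul_of_pos_left h1 hsL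
          rw [mul_add, ← mul_assoc, ← mul_assoc, hsi] at h2
          linarith
        rw [Set.indicator_of_mem (show v ∈ Set.Ioi (x - 1) from hv), Real.norm_of_nonneg
          (mul_nonneg (by positivity) (mul_nonneg (hq0 _) (Real.exp_pos _).le))]
        have h3 : (B L / n L v) ^ β ≤ 2 ^ β := by
          refine Real.rpow_le_rpow (by positivity) ?_ hβ.le
          rw [div_le_iff₀ hn0]
          linarith
        have h4 : Real.exp (s L * B L) * Real.exp (-(s L * n L v)) ≤ Real.exp (-v) := by
          rw [← Real.exp_add]
          refine Real.exp_le_exp.mpr ?_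
          have h2 := mul_le_mul_of_nonneg_left hle hsL.le
          rw [mul_add, ← mul_assoc, hsi] at h2
          linarith
        have h5 : 0 ≤ (n L v : ℝ) ^ β * q (n L v) := mul_nonneg (by positivity) (hq0 _)
        calc B L ^ β * Real.exp (s L * B L) * (q (n L v) * Real.exp (-(s L * n L v)))
            = (B L / n L v) ^ β * ((n L v : ℝ) ^ β * q (n L v)) *
              (Real.exp (s L * B L) * Real.exp (-(s L * n L v))) := by
              rw [div_rpow_mul_rpow_mul hn0 hB0.le]
              ring
          _ ≤ (2 ^ β * C) * Real.exp (-v) := by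
              gcongr
              exact hC _
      · rw [mul_zero, norm_zero]
        refine Set.indicator_nonneg (fun v _ => ?_) v
        positivity
    · rw [integrable_indicator_iff measurableSet_Ioi]
      exact (integrableOn_exp_neg_Ioi _).const_mul _
    · have hne : ∀ᵐ v : ℝ, v ≠ x := by simp [ae_iff]
      filter_upwards [hne] with v hv
      rcases lt_or_gt_of_ne hv with hvx | hvx
      · rw [Set.indicator_of_notMem (by simpa using hvx.le)]
        refine tendsto_const_nhds.congr' ?_
        filter_upwards [hs0, hs.eventually_lt_const (sub_pos.mpr hvx), hpos v,
          hB.eventually_gt_atTop 0] with L hsL hL hpv hB0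
        simp only [hF]
        rw [if_neg, mul_zero]
        rw [not_lt]
        have hlt : (n L v : ℝ) < B L + (s L)⁻¹ * v + 1 := Nat.ceil_lt_add_one (by linarith)
        have h1 : (s L)⁻¹ * v + 1 ≤ x / s L := by
          rw [le_div_iff₀ hsL, add_mul, mul_right_comm, inv_mul_cancel₀ hsL.ne']
          linarith
        linarith
      · rw [Set.indicator_of_mem (by simpa using hvx)]
        have hev : ∀ᶠ L in atTop, B L + (s L)⁻¹ * v ≤ n L v ∧
            (n L v : ℝ) ≤ B L + (s L)⁻¹ * v + 1 := by
          filter_upwards [hpos v, hB.eventually_gt_atTop 0] with L h1 h2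
          exact ⟨Nat.le_ceil _, (Nat.ceil_lt_add_one (by linarith)).le⟩
        have hnB : Tendsto (fun L => (n L v : ℝ) / B L) atTop (𝓝 1) := by
          have hl : Tendsto (fun L => 1 + v / (B L * s L)) atTop (𝓝 1) := by
            simpa using (hBs.const_div_atTop v).const_add 1
          have hu : Tendsto (fun L => 1 + v / (B L * s L) + 1 / B L) atTop (𝓝 1) := by
            simpa using hl.add (hB.const_div_atTop 1)
          refine tendsto_of_tendsto_of_tendsto_of_le_of_le' hl hu ?_ ?_
          · filter_upwards [hev, hB.eventually_gt_atTop 0, hs0] with L h1 h2 h3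
            rw [le_div_iff₀ h2]
            refine le_trans (le_of_eq ?_) h1.1
            field_simp
          · filter_upwards [hev, hB.eventually_gt_atTop 0, hs0] with L h1 h2 h3
            rw [div_le_iff₀ h2]
            refine h1.2.trans (le_of_eq ?_)
            field_simp
        have hninf : Tendsto (fun L => n L v) atTop atTop := by
          refine tendsto_nat_ceil_atTop.comp ?_
          exact tendsto_atTop_mono' _ ((hpos v).mono fun L h => h.le) (hB.atTop_div_const two_pos)
        have hexp : Tendsto (fun L => s L * (n L v - B L)) atTop (𝓝 v) := by
          have hu : Tendsto (fun L => v + s L) atTop (𝓝 v) := by simpa using hs.const_add v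
          refine tendsto_of_tendsto_of_tendsto_of_le_of_le' tendsto_const_nhds hu ?_ ?_
          · filter_upwards [hev, hs0] with L h1 h3
            have h2 : (s L)⁻¹ * v ≤ n L v - B L := by linarith [h1.1]
            rwa [inv_mul_le_iff₀ h3] at h2
          · filter_upwards [hev, hs0] with L h1 h3
            have h2 : (n L v : ℝ) - B L ≤ (s L)⁻¹ * v + 1 := by linarith [h1.2]
            have h4 := mul_le_mul_of_nonneg_left h2 h3.le
            rwa [mul_add, mul_inv_cancel_left₀ h3.ne', mul_one] at h4
        have h3 := (((hnB.inv₀ one_ne_zero).rpow_const (p := β) (Or.inl (by norm_num))).mul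
          (hq.comp hninf)).mul ((Real.continuous_exp.tendsto _).comp hexp.neg)
        rw [inv_one, Real.one_rpow, one_mul] at h3
        refine h3.congr' ?_
        filter_upwards [hs0, hB.eventually_gt_atTop 0, hninf.eventually_gt_atTop 0, hev]
          with L hsL hB0 hnL hle
        have hn0 : (0 : ℝ) < n L v := by exact_mod_cast hnL
        have hcut : B L + x / s L < n L v := by
          refine lt_of_lt_of_le ?_ hle.1
          rw [inv_mul_eq_div]
          have := div_lt_div_of_pos_right hvx hsL
          linarith
        simp only [hF, Function.comp]
        rw [if_pos hcut, inv_div, div_rpow_mul_rpow_mul hn0 hB0.le,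
          show -(s L * ((n L v : ℝ) - B L)) = s L * B L + -(s L * n L v) by ring, Real.exp_add]
        ring
  rw [integral_indicator measurableSet_Ioi, integral_const_mul, integral_exp_neg_Ioi] at hlim
  refine hlim.congr' ?_
  filter_upwards [hs0, hB.eventually_gt_atTop 0, hpos x] with L hsL hB0 hx2
  have h1 := tsum_eq_integral_ceil_affine
    (a := fun k : ℕ => (B L ^ β * Real.exp (s L * B L)) *
      if B L + x / s L < k then q k * Real.exp (-(s L * k)) else 0)
    (by
      rw [inv_mul_eq_div] at hx2
      rw [if_neg, mul_zero]
      rw [not_lt, Nat.cast_zero]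
      linarith)
    (summable_ite_tail hq0 hqs hsL.le _ _) (B L) (inv_pos.mpr hsL)
  rw [tsum_mul_left] at h1
  have h2 : ∫ v, F L v = s L * ((s L)⁻¹ * ∫ v, F L v) := by
    rw [mul_inv_cancel_left₀ hsL.ne']
  rw [h2, ← h1]
  ring

/-! ### Occupation probabilities -/

/-- Nonnegativity of K covers the empty lattice, where the maximum is 0 and the right-hand side is
vacuous. -/
lemma maxOcc_le_iff {L : ℕ} {η : Fin L → ℕ} {K : ℝ} (hK : 0 ≤ K) :
    (maxOcc η : ℝ) ≤ K ↔ ∀ x, (η x : ℝ) ≤ K := by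
  rw [← Nat.le_floor_iff hK, maxOcc, Finset.sup_le_iff]
  simp [Nat.le_floor_iff hK]

lemma canonical_real_maxOcc_le {g : ℕ → ℝ} {p : ℕ → ℝ} (hp : FiniteVarianceLaw p)
    (hgp : marginal g 1 = atomMeasure p) (L N : ℕ) {K : ℝ} (hK : 0 ≤ K) :
    (canonical g L N).real {η | (maxOcc η : ℝ) ≤ K}
      = sumWeight (fun n => if (n : ℝ) ≤ K then p n else 0) L N / sumWeight p L N := by
  have hset : {η : Fin L → ℕ | totalMass η = N} ∩ {η | (maxOcc η : ℝ) ≤ K}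
      = {η | totalMass η = N ∧ ∀ x, (η x : ℝ) ≤ K} := by
    ext η
    exact and_congr_right fun _ => maxOcc_le_iff hK
  rw [canonical, Measure.real,
    ProbabilityTheory.cond_apply (Set.to_countable _).measurableSet, hset, grandCanonical, hgp,
    ENNReal.toReal_mul, ENNReal.toReal_inv, mul_comm, ← div_eq_mul_inv]
  congr 1
  · exact pi_atomMeasure_real_totalMass hp.nonneg hp.hasSum.summable L N fun n => (n : ℝ) ≤ K
  · exact pi_atomMeasure_real_totalMass_eq hp.nonneg hp.hasSum.summable L N

lemma grandCanonical_real_maxOcc_le {g : ℕ → ℝ} {p : ℕ → ℝ} (hp : FiniteVarianceLaw p)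
    (hgp : marginal g 1 = atomMeasure p) (L : ℕ) {K : ℝ} (hK : 0 ≤ K) :
    (grandCanonical g 1 L).real {η | (maxOcc η : ℝ) ≤ K}
      = (1 + -∑' n : ℕ, if K < n then p n else 0) ^ L := by
  have := isFiniteMeasure_atomMeasure hp.nonneg hp.hasSum.summable
  have hset : {η : Fin L → ℕ | (maxOcc η : ℝ) ≤ K}
      = Set.univ.pi fun _ => {n : ℕ | (n : ℝ) ≤ K} := by
    ext η
    simp [maxOcc_le_iff hK]
  have hone : (atomMeasure p).real {n : ℕ | (n : ℝ) ≤ K}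
      = 1 + -∑' n : ℕ, if K < n then p n else 0 := by
    have hs1 : Summable fun n : ℕ => if K < n then p n else 0 :=
      Summable.of_nonneg_of_le (fun n => by split_ifs; exacts [hp.nonneg n, le_rfl])
        (fun n => by split_ifs; exacts [le_rfl, hp.nonneg n]) hp.hasSum.summable
    rw [← integral_indicator_one (Set.to_countable _).measurableSet,
      integral_atomMeasure hp.nonneg, ← sub_eq_add_neg, ← hp.hasSum.tsum_eq,
      ← hp.hasSum.summable.tsum_sub hs1]
    · refine tsum_congr fun n => ?_
      by_cases hn : (n : ℝ) ≤ K
      · simp [hn, not_lt.mpr hn]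
      · simp [hn, not_le.mp hn]
    · refine Summable.of_nonneg_of_le (fun n => mul_nonneg (hp.nonneg n) (norm_nonneg _))
        (fun n => ?_) hp.hasSum.summable
      refine mul_le_of_le_one_right (hp.nonneg n) ?_
      by_cases hn : (n : ℝ) ≤ K <;> simp [hn]
  rw [hset, grandCanonical, hgp, Measure.real, Measure.pi_pi, Finset.prod_const,
    ENNReal.toReal_pow, Finset.card_univ, Fintype.card_fin]
  exact congrArg (· ^ L) hone

/-! ### The stationary weights -/

lemma weight_pos {g : ℕ → ℝ} (hg_nonneg : ∀ n, 0 ≤ g n) (hg_zero : ∀ n, g n = 0 ↔ n = 0) (n : ℕ) :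
    0 < weight g n := by
  refine Finset.prod_pos fun k hk => one_div_pos.mpr ?_
  refine lt_of_le_of_ne (hg_nonneg k) fun h => ?_
  have := (hg_zero k).mp h.symm
  have := (Finset.mem_Icc.mp hk).1
  omega

lemma tendsto_rpow_mul_of_isEquivalent {w : ℕ → ℝ} {A b : ℝ} (hA : 0 < A)
    (hw : w ~[atTop] fun n : ℕ => A * (n : ℝ) ^ (-b)) :
    Tendsto (fun n : ℕ => (n : ℝ) ^ b * w n) atTop (𝓝 A) := by
  have h1 : (fun n : ℕ => (n : ℝ) ^ b * w n) ~[atTop] fun _ => A := by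
    refine ((IsEquivalent.refl (u := fun n : ℕ => (n : ℝ) ^ b)).mul hw).congr_right ?_
    filter_upwards [eventually_gt_atTop 0] with n hn
    have hn' : (0 : ℝ) < n := by exact_mod_cast hn
    have := (Real.rpow_pos_of_pos hn' b).ne'
    simp only [Pi.mul_apply]
    rw [Real.rpow_neg hn'.le]
    field_simp
  exact (isEquivalent_const_iff_tendsto hA.ne').mp h1

lemma summable_rpow_mul_of_isEquivalent {w : ℕ → ℝ} {A b : ℝ}
    (hw : w ~[atTop] fun n : ℕ => A * (n : ℝ) ^ (-b)) (k : ℕ) (hk : k + 1 < b) :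
    Summable fun n : ℕ => (n : ℝ) ^ k * w n := by
  have h1 : (fun n : ℕ => (n : ℝ) ^ k * w n) =O[atTop] fun n : ℕ => (n : ℝ) ^ ((k : ℝ) - b) := by
    have h2 := (isBigO_refl (fun n : ℕ => (n : ℝ) ^ k) atTop).mul
      (hw.isBigO.trans (isBigO_const_mul_self A _ _))
    refine h2.congr' EventuallyEq.rfl ?_
    filter_upwards [eventually_gt_atTop 0] with n hn
    have hn' : (0 : ℝ) < n := by exact_mod_cast hn
    rw [sub_eq_add_neg, Real.rpow_add hn', Real.rpow_natCast]
  exact summable_of_isBigO_nat (Real.summable_nat_rpow.mpr (by linarith)) h1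

/-! ### Scales -/

/-- Here b > 3 is decisive: it says exactly that 1/(b-1) < 1/2. -/
lemma tendsto_rpow_div_sqrt {b : ℝ} (hb : 3 < b) :
    Tendsto (fun L : ℕ => (L : ℝ) ^ (1 / (b - 1)) / √L) atTop (𝓝 0) := by
  have he : 0 < 1 / 2 - 1 / (b - 1) := by
    rw [sub_pos]
    exact one_div_lt_one_div_of_lt two_pos (by linarith)
  refine ((tendsto_rpow_neg_atTop he).comp tendsto_natCast_atTop_atTop).congr' ?_
  filter_upwards [eventually_gt_atTop 0] with L hL
  have hL' : (0 : ℝ) < L := by exact_mod_cast hL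
  simp only [Function.comp]
  rw [Real.sqrt_eq_rpow, ← Real.rpow_sub hL']
  congr 1
  ring

lemma rpow_one_div_rpow {b : ℝ} (hb : 1 < b) (L : ℕ) :
    ((L : ℝ) ^ (1 / (b - 1))) ^ (b - 1) = L := by
  rw [one_div, Real.rpow_inv_rpow L.cast_nonneg (by linarith)]

/-- The function y^b e^y runs continuously from 0 to infinity, and it is bounded on bounded sets, so
its preimages of large values are large. It supplies the centring sequence of the Gumbel regime. -/
lemma exists_inverse_rpow_mul_exp {b : ℝ} (hb : 0 < b) :
    ∃ Y : ℝ → ℝ, (∀ G, 0 ≤ G → 0 ≤ Y G ∧ Y G ^ b * Real.exp (Y G) = G) ∧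
      Tendsto Y atTop atTop := by
  have hex : ∀ G : ℝ, ∃ y : ℝ, 0 ≤ G → 0 ≤ y ∧ y ^ b * Real.exp y = G := by
    intro G
    by_cases hG : 0 ≤ G
    · have hc : ContinuousOn (fun y : ℝ => y ^ b * Real.exp y) (Set.Icc 0 (G + 1)) :=
        ((Real.continuous_rpow_const hb.le).mul Real.continuous_exp).continuousOn
      have hmem : G ∈ Set.Icc ((0 : ℝ) ^ b * Real.exp 0) ((G + 1) ^ b * Real.exp (G + 1)) := by
        constructor
        · rw [Real.zero_rpow hb.ne', zero_mul]
          exact hG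
        · have h1 : 1 ≤ (G + 1) ^ b := Real.one_le_rpow (by linarith) hb.le
          have h2 := Real.add_one_le_exp (G + 1)
          nlinarith
      obtain ⟨y, hy, hy2⟩ := intermediate_value_Icc (by linarith) hc hmem
      exact ⟨y, fun _ => ⟨hy.1, hy2⟩⟩
    · exact ⟨0, fun h => absurd h hG⟩
  choose Y hY using hex
  refine ⟨Y, hY, tendsto_atTop.mpr fun R => ?_⟩
  filter_upwards [eventually_gt_atTop (max R 0 ^ b * Real.exp (max R 0)), eventually_ge_atTop 0]
    with G hG hG0
  by_contra hcon
  push Not at hcon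
  obtain ⟨h1, h2⟩ := hY G hG0
  have h3 : Y G ≤ max R 0 := hcon.le.trans (le_max_left _ _)
  have h4 : Y G ^ b * Real.exp (Y G) ≤ max R 0 ^ b * Real.exp (max R 0) :=
    mul_le_mul (Real.rpow_le_rpow h1 h3 hb.le) (Real.exp_le_exp.mpr h3) (Real.exp_pos _).le
      (by positivity)
  linarith

/-! ### The two regimes of the maximum -/

namespace FiniteVarianceLaw

variable {p : ℕ → ℝ}

/-- Lets the tail theorems apply to first moments, with exponent b - 1 in place of b. -/
lemma tendsto_rpow_mul_mean {A b : ℝ}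
    (hpA : Tendsto (fun n : ℕ => (n : ℝ) ^ b * p n) atTop (𝓝 A)) :
    Tendsto (fun n : ℕ => (n : ℝ) ^ (b - 1) * (n * p n)) atTop (𝓝 A) := by
  refine hpA.congr' ?_
  filter_upwards [eventually_gt_atTop 0] with n hn
  have hn' : (0 : ℝ) < n := by exact_mod_cast hn
  rw [Real.rpow_sub hn', Real.rpow_one]
  field_simp

/-- The maximum on the scale `L^{1/(b-1)}`, for deviations of the particle number at most of
order `L^{(b-2)/(b-1)}`. -/
theorem tendsto_ratio_of_scale (h : FiniteVarianceLaw p) {A b : ℝ} (hb : 3 < b)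
    (hpA : Tendsto (fun n : ℕ => (n : ℝ) ^ b * p n) atTop (𝓝 A)) {s : ℕ → ℝ} {N : ℕ → ℕ} {ω x : ℝ}
    (hs : Tendsto s atTop (𝓝 0)) (hs0 : ∀ᶠ L in atTop, 0 ≤ s L)
    (hmean : ∀ᶠ L : ℕ in atTop, (L : ℝ) * ∑' n : ℕ, (n : ℝ) * (p n * Real.exp (-(s L * n)))
      = N L * ∑' n : ℕ, p n * Real.exp (-(s L * n)))
    (hsr : Tendsto (fun L : ℕ => s L * (L : ℝ) ^ (1 / (b - 1))) atTop (𝓝 ω)) (hx : 0 < x) :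
    Tendsto (fun L : ℕ => sumWeight (fun n => if (n : ℝ) ≤ x * (L : ℝ) ^ (1 / (b - 1)) then p n
      else 0) L (N L) / sumWeight p L (N L)) atTop
      (𝓝 (Real.exp (-(A * ∫ t in Set.Ioi x, Real.exp (-(ω * t)) / t ^ b)))) := by
  have hrt : Tendsto (fun L : ℕ => (L : ℝ) ^ (1 / (b - 1))) atTop atTop :=
    (tendsto_rpow_atTop (one_div_pos.mpr (by linarith))).comp tendsto_natCast_atTop_atTop
  refine h.tendsto_sumWeight_ratio hs hs0 (hrt.const_mul_atTop hx) hmean ?_ ?_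
  · have := tendsto_tail_of_scale h.nonneg h.hasSum.summable hpA (by linarith) hs0 hrt hsr hx
    simpa only [rpow_one_div_rpow (show 1 < b by linarith)] using this
  · have h1 := tendsto_tail_of_scale (fun n => mul_nonneg n.cast_nonneg (h.nonneg n))
      h.summable_mean (tendsto_rpow_mul_mean hpA) (by linarith) hs0 hrt hsr hx
    -- With r = L^{1/(b-1)} one has r^{b-2} = L/r, so √L times the first-moment tail is r/√L times a
    -- convergent quantity.
    have h2 := (tendsto_rpow_div_sqrt hb).mul h1
    rw [zero_mul] at h2
    refine h2.congr' ?_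
    filter_upwards [eventually_gt_atTop 0] with L hL
    have hL' : (0 : ℝ) < L := by exact_mod_cast hL
    have hr : 0 < (L : ℝ) ^ (1 / (b - 1)) := Real.rpow_pos_of_pos hL' _
    rw [Real.rpow_sub hr, rpow_one_div_rpow (show 1 < b by linarith), Real.rpow_one, ← mul_assoc]
    congr 1
    have hq : √(L : ℝ) * √L = L := Real.mul_self_sqrt hL'.le
    have hq0 : 0 < √(L : ℝ) := Real.sqrt_pos.mpr hL'
    field_simp
    rw [sq, hq]

/-- The maximum in the Gumbel regime. -/
theorem exists_gumbel_ratio (h : FiniteVarianceLaw p) {A b : ℝ} (hb : 3 < b) (hA : 0 < A)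
    (hpA : Tendsto (fun n : ℕ => (n : ℝ) ^ b * p n) atTop (𝓝 A)) {s : ℕ → ℝ} {N : ℕ → ℕ}
    (hs : Tendsto s atTop (𝓝 0)) (hs0 : ∀ᶠ L in atTop, 0 < s L)
    (hmean : ∀ᶠ L : ℕ in atTop, (L : ℝ) * ∑' n : ℕ, (n : ℝ) * (p n * Real.exp (-(s L * n)))
      = N L * ∑' n : ℕ, p n * Real.exp (-(s L * n)))
    (hsr : Tendsto (fun L : ℕ => s L * (L : ℝ) ^ (1 / (b - 1))) atTop atTop) :
    ∃ B : ℕ → ℝ, Tendsto B atTop atTop ∧ Tendsto (fun L => B L * s L) atTop atTop ∧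
      ∀ x : ℝ, Tendsto (fun L => B L + x / s L) atTop atTop ∧
        Tendsto (fun L : ℕ => sumWeight (fun n => if (n : ℝ) ≤ B L + x / s L then p n else 0) L (N L)
          / sumWeight p L (N L)) atTop (𝓝 (Real.exp (-Real.exp (-x)))) := by
  obtain ⟨Y, hY, hYt⟩ := exists_inverse_rpow_mul_exp (b := b) (by linarith)
  have hG : Tendsto (fun L : ℕ => A * (s L * (L : ℝ) ^ (1 / (b - 1))) ^ (b - 1)) atTop atTop :=
    ((tendsto_rpow_atTop (by linarith)).comp hsr).const_mul_atTop hA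
  -- Here y = s B solves y^b e^y = A s^{b-1} L, which is s B^b e^{sB} = A L. The normalising factor
  -- of `tendsto_tail_of_damped` thereby becomes A L.
  set y : ℕ → ℝ := fun L => Y (A * (s L * (L : ℝ) ^ (1 / (b - 1))) ^ (b - 1)) with hy
  have hyt : Tendsto y atTop atTop := hYt.comp hG
  set B : ℕ → ℝ := fun L => y L / s L with hB
  have hBs : ∀ᶠ L in atTop, B L * s L = y L := by
    filter_upwards [hs0] with L hL
    exact div_mul_cancel₀ _ hL.ne'
  have hBst : Tendsto (fun L => B L * s L) atTop atTop :=
    hyt.congr' (hBs.mono fun L hL => hL.symm)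
  have hBt : Tendsto B atTop atTop := by
    have hinv : Tendsto (fun L => (s L)⁻¹) atTop atTop :=
      tendsto_inv_nhdsGT_zero.comp (tendsto_nhdsWithin_iff.mpr ⟨hs, hs0⟩)
    exact hyt.atTop_mul_atTop₀ hinv
  have hBeq : ∀ᶠ L : ℕ in atTop, s L * B L ^ b * Real.exp (s L * B L) = L * A := by
    filter_upwards [hs0, hBs, hG.eventually_ge_atTop 0] with L hsL h1 h2
    obtain ⟨hy0, hy1⟩ := hY _ h2
    change 0 ≤ y L at hy0
    change y L ^ b * Real.exp (y L) = _ at hy1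
    rw [mul_comm (s L) (B L), h1, hB]
    simp only
    rw [Real.div_rpow hy0 hsL.le]
    rw [Real.mul_rpow hsL.le (by positivity), rpow_one_div_rpow (show 1 < b by linarith),
      Real.rpow_sub hsL, Real.rpow_one] at hy1
    have hsb := Real.rpow_pos_of_pos hsL b
    field_simp at hy1 ⊢
    linarith
  -- Once s B ≥ 1, the defining equation gives B^{b-1} ≤ A L, so B = O(L^{1/(b-1)}) = o(√L).
  have hBsqrt : Tendsto (fun L : ℕ => B L / √L) atTop (𝓝 0) := by
    have h1 := (tendsto_rpow_div_sqrt hb).const_mul (A ^ (1 / (b - 1)))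
    rw [mul_zero] at h1
    refine squeeze_zero' ?_ ?_ h1
    · filter_upwards [hBt.eventually_ge_atTop 0] with L hL
      positivity
    · filter_upwards [hBeq, hBt.eventually_gt_atTop 0, hBst.eventually_ge_atTop 1] with L h2 h3 h4
      rw [← mul_div_assoc]
      refine div_le_div_of_nonneg_right ?_ (Real.sqrt_nonneg _)
      have h5 : B L ^ (b - 1) ≤ L * A := by
        rw [← h2, Real.rpow_sub h3, Real.rpow_one]
        have h6 := Real.one_le_exp (show 0 ≤ s L * B L by linarith)
        have h7 : s L * B L ^ b * Real.exp (s L * B L)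
            = B L ^ b / B L * ((B L * s L) * Real.exp (s L * B L)) := by
          field_simp
        rw [h7]
        refine le_mul_of_one_le_right (by positivity) ?_
        nlinarith
      rw [← Real.mul_rpow hA.le L.cast_nonneg, one_div, mul_comm A]
      rwa [Real.le_rpow_inv_iff_of_pos h3.le (by positivity) (by linarith)]
  refine ⟨B, hBt, hBst, fun x => ?_⟩
  have hKt : Tendsto (fun L => B L + x / s L) atTop atTop := by
    refine tendsto_atTop_mono' _ ?_ (hBt.atTop_div_const two_pos)
    filter_upwards [hs0, hBst.eventually_gt_atTop (-2 * x)] with L hsL hL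
    have : -(B L / 2) ≤ x / s L := by
      rw [le_div_iff₀ hsL]
      linarith
    linarith
  refine ⟨hKt, h.tendsto_sumWeight_ratio hs (hs0.mono fun L hL => hL.le) hKt hmean ?_ ?_⟩
  · have h1 := (tendsto_tail_of_damped h.nonneg h.hasSum.summable hpA (by linarith) hs0 hs hBt hBst
      x).div_const A
    rw [mul_div_cancel_left₀ _ hA.ne'] at h1
    refine h1.congr' ?_
    filter_upwards [hBeq] with L hL
    rw [hL]
    field_simp
  · have h1 := tendsto_tail_of_damped (fun n => mul_nonneg n.cast_nonneg (h.nonneg n))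
      h.summable_mean (tendsto_rpow_mul_mean hpA) (by linarith) hs0 hs hBt hBst x
    -- For exponent b - 1 the normalising factor is A L/B, so √L times the first-moment tail is B/(A
    -- √L) times a convergent quantity.
    have h2 := (hBsqrt.div_const A).mul h1
    rw [zero_div, zero_mul] at h2
    refine h2.congr' ?_
    filter_upwards [hBeq, hBt.eventually_gt_atTop 0, eventually_gt_atTop 0] with L hL hB0 hLpos
    have hL' : (0 : ℝ) < L := by exact_mod_cast hLpos
    have h3 : s L * B L ^ (b - 1) * Real.exp (s L * B L) = L * A / B L := by
      rw [← hL, Real.rpow_sub hB0, Real.rpow_one]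
      ring
    rw [h3, ← mul_assoc]
    congr 1
    have hq : √(L : ℝ) * √L = L := Real.mul_self_sqrt hL'.le
    have hq0 : 0 < √(L : ℝ) := Real.sqrt_pos.mpr hL'
    field_simp
    rw [sq, hq]

end FiniteVarianceLaw

/-! ### Transfer to the zero-range measures -/

lemma integral_Ioi_one_div_rpow {b x : ℝ} (hb : 1 < b) (hx : 0 < x) :
    ∫ t in Set.Ioi x, Real.exp (-(0 * t)) / t ^ b = x ^ (1 - b) / (b - 1) := by
  have h1 : Set.EqOn (fun t : ℝ => Real.exp (-(0 * t)) / t ^ b) (fun t => t ^ (-b)) (Set.Ioi x) := by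
    intro t ht
    have ht0 : (0 : ℝ) < t := hx.trans ht
    simp [Real.rpow_neg ht0.le]
  rw [setIntegral_congr_fun measurableSet_Ioi h1, integral_Ioi_rpow_of_lt (by linarith) hx,
    neg_add_eq_sub, ← neg_sub b 1, div_neg, neg_div, neg_neg]

lemma finiteVarianceLaw_marginal {g : ℕ → ℝ} (hg_nonneg : ∀ n, 0 ≤ g n)
    (hg_zero : ∀ n, g n = 0 ↔ n = 0) {b A : ℝ} (hb : 3 < b)
    (hw : IsEquivalent atTop (weight g) (fun n : ℕ => A * (n : ℝ) ^ (-b))) :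
    FiniteVarianceLaw fun n => weight g n * 1 ^ n / partitionFunction g 1 := by
  have hpos := weight_pos hg_nonneg hg_zero
  have hs : Summable (weight g) := by
    simpa using summable_rpow_mul_of_isEquivalent hw 0 (by norm_num; linarith)
  have hZ : partitionFunction g 1 = ∑' n, weight g n := by simp [partitionFunction]
  have hZpos : 0 < partitionFunction g 1 := by
    rw [hZ]
    exact hs.tsum_pos (fun n => (hpos n).le) 0 (hpos 0)
  have hppos : ∀ n, 0 < weight g n * 1 ^ n / partitionFunction g 1 := fun n =>
    div_pos (by simpa using hpos n) hZpos
  refine ⟨fun n => (hppos n).le, ?_, hppos 0, hppos 1, ?_⟩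
  · have := hs.hasSum.div_const (partitionFunction g 1)
    rw [← hZ, div_self hZpos.ne'] at this
    simpa using this
  · refine ((summable_rpow_mul_of_isEquivalent hw 2 (by norm_num; linarith)).div_const
      (partitionFunction g 1)).congr fun n => ?_
    rw [one_pow, mul_one, mul_div_assoc]

lemma density_eq_tsum {g p : ℕ → ℝ} (hp : FiniteVarianceLaw p)
    (hgp : marginal g 1 = atomMeasure p) : rhoC g = ∑' n : ℕ, (n : ℝ) * p n := by
  rw [rhoC, density, hgp, integral_atomMeasure hp.nonneg]
  · exact tsum_congr fun n => mul_comm _ _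
  · refine hp.summable_mean.congr fun n => ?_
    rw [Real.norm_of_nonneg n.cast_nonneg, mul_comm]

lemma sigmaSq_eq_tsum {g p : ℕ → ℝ} (hp : FiniteVarianceLaw p)
    (hgp : marginal g 1 = atomMeasure p) :
    sigmaSq g = (∑' n : ℕ, (n : ℝ) ^ 2 * p n) - (∑' n : ℕ, (n : ℝ) * p n) ^ 2 := by
  rw [sigmaSq, density_eq_tsum hp hgp, hgp, integral_atomMeasure hp.nonneg]
  · congr 1
    exact tsum_congr fun n => mul_comm _ _
  · refine hp.summable_sq.congr fun n => ?_
    rw [Real.norm_of_nonneg (sq_nonneg _), mul_comm]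

/-- Tilts matching the canonical particle density, if the deviation from the critical density
is nonnegative and vanishes asymptotically. -/
lemma exists_canonical_tilt {g p : ℕ → ℝ} (hp : FiniteVarianceLaw p)
    (hgp : marginal g 1 = atomMeasure p) {b : ℝ} (hb : 3 < b) {N : ℕ → ℕ} {ω : ℕ → ℝ}
    (hω : ∀ᶠ L : ℕ in atTop, 0 ≤ ω L)
    (hN : ∀ᶠ L : ℕ in atTop, (N L : ℝ) = rhoC g * (L : ℝ)
      - ω L * sigmaSq g * (L : ℝ) ^ ((b - 2) / (b - 1)))
    (hd : Tendsto (fun L : ℕ => (N L : ℝ) / L) atTop (𝓝 (rhoC g))) :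
    ∃ s : ℕ → ℝ, (∀ᶠ L in atTop, 0 ≤ s L) ∧ Tendsto s atTop (𝓝 0) ∧
      (∀ᶠ L : ℕ in atTop, (L : ℝ) * ∑' n : ℕ, (n : ℝ) * (p n * Real.exp (-(s L * n)))
        = N L * ∑' n : ℕ, p n * Real.exp (-(s L * n))) ∧
      IsEquivalent atTop s
        (fun L : ℕ => (rhoC g * (L : ℝ) - (N L : ℝ)) / (sigmaSq g * (L : ℝ))) ∧
      IsEquivalent atTop (fun L : ℕ => s L * (L : ℝ) ^ (1 / (b - 1))) ω := by
  have hσ : 0 < sigmaSq g := by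
    rw [sigmaSq_eq_tsum hp hgp, ← hp.variance_eq]
    exact hp.variance_pos
  have hd0 : Tendsto (fun L : ℕ => rhoC g - (N L : ℝ) / L) atTop (𝓝 0) := by
    simpa using hd.const_sub (rhoC g)
  -- The deficit per site is ω σ² L^{-1/(b-1)}; division by σ² is what makes s L^{1/(b-1)}
  -- equivalent to ω.
  have hdω : ∀ᶠ L : ℕ in atTop,
      rhoC g - (N L : ℝ) / L = ω L * sigmaSq g / (L : ℝ) ^ (1 / (b - 1)) := by
    filter_upwards [hN, eventually_gt_atTop 0] with L hL hLpos
    have hL' : (0 : ℝ) < L := by exact_mod_cast hLpos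
    have he : (b - 2) / (b - 1) = 1 - 1 / (b - 1) := by
      have : b - 1 ≠ 0 := by linarith
      field_simp
      ring
    have hr : 0 < (L : ℝ) ^ (1 / (b - 1)) := Real.rpow_pos_of_pos hL' _
    rw [hL, he, Real.rpow_sub hL', Real.rpow_one]
    field_simp
    ring
  have hdnn : ∀ᶠ L : ℕ in atTop, 0 ≤ rhoC g - (N L : ℝ) / L := by
    filter_upwards [hdω, hω] with L h1 h2
    rw [h1]
    positivity
  obtain ⟨s, hs0, hs, hm, hse⟩ := hp.exists_tilt hd0 hdnn
  rw [← density_eq_tsum hp hgp] at hm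
  rw [← sigmaSq_eq_tsum hp hgp] at hse
  refine ⟨s, hs0, hs, ?_, hse.congr_right ?_, ?_⟩
  · filter_upwards [hm, eventually_gt_atTop 0] with L hL hLpos
    have hL' : (0 : ℝ) < L := by exact_mod_cast hLpos
    rw [hL]
    field_simp
    ring
  · filter_upwards [eventually_gt_atTop 0] with L hLpos
    have hL' : (0 : ℝ) < L := by exact_mod_cast hLpos
    field_simp
  · refine (hse.mul (IsEquivalent.refl (u := fun L : ℕ => (L : ℝ) ^ (1 / (b - 1))))).congr_right ?_
    filter_upwards [hdω, eventually_gt_atTop 0] with L hL hLpos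
    have hL' : (0 : ℝ) < L := by exact_mod_cast hLpos
    have hr : 0 < (L : ℝ) ^ (1 / (b - 1)) := Real.rpow_pos_of_pos hL' _
    simp only [Pi.mul_apply]
    rw [hL]
    field_simp

/-- If `ω` converges, the particle density converges to the critical density. -/
lemma tendsto_density_of_scale {b ρ σ ω₀ : ℝ} (hb : 3 < b) {N : ℕ → ℕ} {ω : ℕ → ℝ}
    (hN : ∀ᶠ L : ℕ in atTop, (N L : ℝ) = ρ * (L : ℝ) - ω L * σ * (L : ℝ) ^ ((b - 2) / (b - 1)))
    (hω : Tendsto ω atTop (𝓝 ω₀)) : Tendsto (fun L : ℕ => (N L : ℝ) / L) atTop (𝓝 ρ) := by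
  have he : 0 < 1 / (b - 1) := one_div_pos.mpr (by linarith)
  have h1 := ((hω.mul_const σ).mul
    ((tendsto_rpow_neg_atTop he).comp tendsto_natCast_atTop_atTop)).const_sub ρ
  rw [mul_zero, sub_zero] at h1
  refine h1.congr' ?_
  filter_upwards [hN, eventually_gt_atTop 0] with L hL hLpos
  have hL' : (0 : ℝ) < L := by exact_mod_cast hLpos
  have he : (b - 2) / (b - 1) = 1 + -(1 / (b - 1)) := by
    have : b - 1 ≠ 0 := by linarith
    field_simp
    ring
  simp only [Function.comp]
  rw [hL, he, Real.rpow_add hL', Real.rpow_one]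
  field_simp

/-- A limit ω₀ = 0 is allowed, so this serves both the Fréchet case and the exponentially damped
case. -/
lemma tendsto_canonical_of_scale {g p : ℕ → ℝ} (hp : FiniteVarianceLaw p)
    (hgp : marginal g 1 = atomMeasure p) {b A : ℝ} (hb : 3 < b)
    (hpA : Tendsto (fun n : ℕ => (n : ℝ) ^ b * p n) atTop (𝓝 A)) {N : ℕ → ℕ} {ω : ℕ → ℝ}
    (hω : ∀ᶠ L : ℕ in atTop, 0 ≤ ω L)
    (hN : ∀ᶠ L : ℕ in atTop, (N L : ℝ) = rhoC g * (L : ℝ)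
      - ω L * sigmaSq g * (L : ℝ) ^ ((b - 2) / (b - 1)))
    {ω₀ : ℝ} (hlim : Tendsto ω atTop (𝓝 ω₀)) {x : ℝ} (hx : 0 < x) :
    Tendsto (fun L : ℕ => (canonical g L (N L)).real
        {η | (maxOcc η : ℝ) / (L : ℝ) ^ (1 / (b - 1)) ≤ x}) atTop
      (𝓝 (Real.exp (-(A * ∫ t in Set.Ioi x, Real.exp (-(ω₀ * t)) / t ^ b)))) := by
  obtain ⟨s, hs0, hs, hm, -, hsr⟩ :=
    exists_canonical_tilt hp hgp hb hω hN (tendsto_density_of_scale hb hN hlim)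
  refine (hp.tendsto_ratio_of_scale hb hpA hs hs0 hm (hsr.symm.tendsto_nhds hlim) hx).congr' ?_
  filter_upwards [eventually_gt_atTop 0] with L hLpos
  have hL' : (0 : ℝ) < L := by exact_mod_cast hLpos
  have hr : 0 < (L : ℝ) ^ (1 / (b - 1)) := Real.rpow_pos_of_pos hL' _
  rw [← canonical_real_maxOcc_le hp hgp L (N L) (mul_pos hx hr).le]
  simp_rw [div_le_iff₀ hr]

lemma tendsto_grandCanonical {g p : ℕ → ℝ} (hp : FiniteVarianceLaw p)
    (hgp : marginal g 1 = atomMeasure p) {b A : ℝ} (hb : 3 < b)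
    (hpA : Tendsto (fun n : ℕ => (n : ℝ) ^ b * p n) atTop (𝓝 A)) {x : ℝ} (hx : 0 < x) :
    Tendsto (fun L : ℕ => (grandCanonical g 1 L).real
        {η | (maxOcc η : ℝ) / (L : ℝ) ^ (1 / (b - 1)) ≤ x}) atTop
      (𝓝 (Real.exp (-(A * x ^ (1 - b) / (b - 1))))) := by
  have hrt : Tendsto (fun L : ℕ => (L : ℝ) ^ (1 / (b - 1))) atTop atTop :=
    (tendsto_rpow_atTop (one_div_pos.mpr (by linarith))).comp tendsto_natCast_atTop_atTop
  -- Without conditioning no tilt is needed: the tail theorem is used with s = 0.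
  have htail := tendsto_tail_of_scale (s := fun _ => 0) (ω := 0) hp.nonneg hp.hasSum.summable hpA
    (by linarith) (Eventually.of_forall fun _ => le_rfl) hrt (by simp) hx
  simp only [rpow_one_div_rpow (show 1 < b by linarith), zero_mul, neg_zero, Real.exp_zero,
    mul_one] at htail
  have hval := integral_Ioi_one_div_rpow (show 1 < b by linarith) hx
  simp only [zero_mul, neg_zero, Real.exp_zero] at hval
  rw [hval, ← mul_div_assoc] at htail
  have hpow := Real.tendsto_one_add_pow_exp_of_tendsto (htail.neg.congr fun L => by
    rw [← mul_neg])
  refine hpow.congr' ?_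
  filter_upwards [eventually_gt_atTop 0] with L hLpos
  have hL' : (0 : ℝ) < L := by exact_mod_cast hLpos
  have hr : 0 < (L : ℝ) ^ (1 / (b - 1)) := Real.rpow_pos_of_pos hL' _
  rw [← grandCanonical_real_maxOcc_le hp hgp L (mul_pos hx hr).le]
  simp_rw [div_le_iff₀ hr]

end ZeroRange

/-! ### The three regimes -/

theorem theorem2
    (g : ℕ → ℝ) (hg_nonneg : ∀ n, 0 ≤ g n) (hg_zero : ∀ n, g n = 0 ↔ n = 0)
    (b : ℝ) (hb : 3 < b)
    (A : ℝ) (hA : 0 < A)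
    (hw : Asymptotics.IsEquivalent atTop (ZeroRange.weight g)
      (fun n : ℕ => A * (n : ℝ) ^ (-b)))
    (A₁ : ℝ) (hA₁ : A₁ = A / ZeroRange.partitionFunction g 1)
    (N : ℕ → ℕ) (ω : ℕ → ℝ)
    (hω_nonneg : ∀ᶠ L : ℕ in atTop, 0 ≤ ω L)
    (hN : ∀ᶠ L : ℕ in atTop, (N L : ℝ) = ZeroRange.rhoC g * (L : ℝ)
      - ω L * ZeroRange.sigmaSq g * (L : ℝ) ^ ((b - 2) / (b - 1))) :
    (Tendsto ω atTop (𝓝 0) → ∀ x : ℝ, 0 < x →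
      Tendsto (fun L : ℕ => (ZeroRange.canonical g L (N L)).real
          {η | (ZeroRange.maxOcc η : ℝ) / (L : ℝ) ^ (1 / (b - 1)) ≤ x})
        atTop (𝓝 (Real.exp (-(A₁ * x ^ (1 - b) / (b - 1))))) ∧
      Tendsto (fun L : ℕ => (ZeroRange.grandCanonical g 1 L).real
          {η | (ZeroRange.maxOcc η : ℝ) / (L : ℝ) ^ (1 / (b - 1)) ≤ x})
        atTop (𝓝 (Real.exp (-(A₁ * x ^ (1 - b) / (b - 1)))))) ∧
    (∀ ω₀ : ℝ, 0 < ω₀ → Tendsto ω atTop (𝓝 ω₀) → ∀ x : ℝ, 0 < x →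
      Tendsto (fun L : ℕ => (ZeroRange.canonical g L (N L)).real
          {η | (ZeroRange.maxOcc η : ℝ) / (L : ℝ) ^ (1 / (b - 1)) ≤ x})
        atTop (𝓝 (Real.exp (-(A₁ * ∫ t in Set.Ioi x, Real.exp (-(ω₀ * t)) / t ^ b))))) ∧
    (Tendsto ω atTop atTop →
      Tendsto (fun L : ℕ => (N L : ℝ) / (L : ℝ)) atTop (𝓝 (ZeroRange.rhoC g)) →
      ∃ B s : ℕ → ℝ,
        Tendsto B atTop atTop ∧
        Asymptotics.IsEquivalent atTop s (fun L : ℕ =>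
          (ZeroRange.rhoC g * (L : ℝ) - (N L : ℝ)) / (ZeroRange.sigmaSq g * (L : ℝ))) ∧
        Tendsto (fun L : ℕ => B L * s L) atTop atTop ∧
        ∀ x : ℝ, Tendsto (fun L : ℕ => (ZeroRange.canonical g L (N L)).real
            {η | ((ZeroRange.maxOcc η : ℝ) - B L) / (1 / s L) ≤ x})
          atTop (𝓝 (Real.exp (-Real.exp (-x))))) := by
  -- The factor `1 ^ n` is kept so that the marginal is definitionally `atomMeasure p`.
  set p : ℕ → ℝ := fun n => ZeroRange.weight g n * 1 ^ n / ZeroRange.partitionFunction g 1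
    with hp_def
  have hp : ZeroRange.FiniteVarianceLaw p :=
    ZeroRange.finiteVarianceLaw_marginal hg_nonneg hg_zero hb hw
  have hgp : ZeroRange.marginal g 1 = ZeroRange.atomMeasure p := rfl
  have hZ : 0 < ZeroRange.partitionFunction g 1 := by
    have h1 := hp.pos_zero
    have h2 := ZeroRange.weight_pos hg_nonneg hg_zero 0
    rw [hp_def] at h1
    simp only [pow_zero, mul_one] at h1
    exact (div_pos_iff_of_pos_left h2).mp h1
  have hA₁pos : 0 < A₁ := hA₁ ▸ div_pos hA hZ
  have hpA : Tendsto (fun n : ℕ => (n : ℝ) ^ b * p n) atTop (𝓝 A₁) := by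
    rw [hA₁]
    refine ((ZeroRange.tendsto_rpow_mul_of_isEquivalent hA hw).div_const _).congr fun n => ?_
    rw [hp_def]
    simp only [one_pow, mul_one]
    rw [mul_div_assoc]
  refine ⟨fun hω x hx => ⟨?_, ZeroRange.tendsto_grandCanonical hp hgp hb hpA hx⟩,
    fun ω₀ _ hω x hx =>
      ZeroRange.tendsto_canonical_of_scale hp hgp hb hpA hω_nonneg hN hω hx,
    fun hω hdens => ?_⟩
  · have := ZeroRange.tendsto_canonical_of_scale hp hgp hb hpA hω_nonneg hN hω hx
    rwa [ZeroRange.integral_Ioi_one_div_rpow (by linarith) hx, ← mul_div_assoc] at this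
  · obtain ⟨s, -, hs, hm, hse, hsr⟩ :=
      ZeroRange.exists_canonical_tilt hp hgp hb hω_nonneg hN hdens
    have hsrt := hsr.symm.tendsto_atTop hω
    -- The tilt is a priori only nonnegative; ω → ∞ makes it strictly positive, as division by s
    -- requires.
    have hspos : ∀ᶠ L in atTop, 0 < s L := by
      filter_upwards [hsrt.eventually_gt_atTop 0] with L hL
      exact pos_of_mul_pos_left hL (by positivity)
    obtain ⟨B, hB, hBs, hlim⟩ := hp.exists_gumbel_ratio hb hA₁pos hpA hs hspos hm hsrt
    refine ⟨B, s, hB, hse, hBs, fun x => (hlim x).2.congr' ?_⟩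
    filter_upwards [hspos, (hlim x).1.eventually_ge_atTop 0] with L hsL hK
    rw [← ZeroRange.canonical_real_maxOcc_le hp hgp L (N L) hK]
    have hset : ∀ M : ℝ, (M - B L) / (1 / s L) ≤ x ↔ M ≤ B L + x / s L := by
      intro M
      rw [div_le_iff₀ (one_div_pos.mpr hsL), mul_one_div, sub_le_iff_le_add']
    simp_rw [hset]
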